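/- **Theorem (Multivalued WSO).** Work in higher-order intuitionistic logic with natural numbers (the internal language of an elementary topos with a natural numbers object: types are generated from a one-element type, $\mathbb{N}$ and the type $\Omega$ of truth values by binary products and power types, with full comprehension, extensionality of sets and of truth values, and Peano's axioms; maps between sets are functional relations), extended by the axioms * *Countable Choice*: for every type $A$, every relation $R \subseteq \mathbb{N} \times A$ with $\forall n\, \exists x\, R(n,x)$ contains the graph of a map $\mathbb{N} \to A$; * *Enumerability Axiom*: there is a surjection $\mathbb{N} \to \Sigma^{\mathbb{N}}$; * *Markov's principle*: if not all terms of a binary sequence are zero, then the sequence contains a one. Here $\Sigma = \{p \in \Omega \mid \exists f \in 2^{\mathbb{N}}\,(p \Leftrightarrow \exists n \in \mathbb{N}\, f(n) = 1)\}$ is the set of semidecidable truth values, with $2 = \{0,1\}$. Let $$\mathbb{N}_\infty = \{t \in 2^{\mathbb{N}} \mid \forall n \in \mathbb{N}\; t(n) \ge t(n+1)\},$$ let $\infty \in \mathbb{N}_\infty$ be the sequence of all ones, and regard $n \in \mathbb{N}$ as the element of $\mathbb{N}_\infty$ whose $i$-th term is $1$ if and only if $i < n$. A multivalued map $U : X \rightrightarrows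 Y$ is a map from $X$ to the set of inhabited subsets of $Y$. Then the following is derivable: for every multivalued map $U : \mathbb{N}_\infty \rightrightarrows \Sigma$ such that $U(\infty) = \{\top\}$, there is $n \in \mathbb{N}$ such that $\top \in U(n)$. -/

import Mathlib

/-!
# Higher-order intuitionistic logic with arithmetic, and synthetic computability in it

In Lean's own logic the Enumerability Axiom is refutable, so a constructive theorem which rests on
it has to be stated as derivability in higher-order intuitionistic logic.  The calculus below is
the pure type theory that is the internal language of an elementary topos with a natural numbers
object: types are built from the one-element type, the natural numbers and the type of truth
values by products and power types; terms are intrinsically typed, with de Bruijn variables; a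
formula is a term of the type of truth values.  A set is a term of a power type, and a map between
sets is identified with its graph.
-/

namespace IHOL

/-- Types: the one-element type, natural numbers, truth values, products, power types. -/
inductive Ty : Type
  | one : Ty
  | nat : Ty
  | om : Ty
  | prod : Ty → Ty → Ty
  | pow : Ty → Ty

/-- A context lists the types of the free variables, the most recently bound one first. -/
abbrev Ctx : Type := List Ty

/-- Variables of type `A` in a context. -/
inductive Var : Ctx → Ty → Type
  | z {Γ : Ctx} {A : Ty} : Var (A :: Γ) A
  | s {Γ : Ctx} {A B : Ty} : Var Γ A → Var (B :: Γ) A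

/-- Terms of type `A` in a context; `compr A φ` is the set `{x : A | φ}`. -/
inductive Tm : Ctx → Ty → Type
  | var {Γ : Ctx} {A : Ty} : Var Γ A → Tm Γ A
  | star {Γ : Ctx} : Tm Γ Ty.one
  | zero {Γ : Ctx} : Tm Γ Ty.nat
  | succ {Γ : Ctx} : Tm Γ Ty.nat → Tm Γ Ty.nat
  | pair {Γ : Ctx} {A B : Ty} : Tm Γ A → Tm Γ B → Tm Γ (Ty.prod A B)
  | compr {Γ : Ctx} (A : Ty) : Tm (A :: Γ) Ty.om → Tm Γ (Ty.pow A)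
  | mem {Γ : Ctx} {A : Ty} : Tm Γ A → Tm Γ (Ty.pow A) → Tm Γ Ty.om
  | eq {Γ : Ctx} {A : Ty} : Tm Γ A → Tm Γ A → Tm Γ Ty.om
  | top {Γ : Ctx} : Tm Γ Ty.om
  | bot {Γ : Ctx} : Tm Γ Ty.om
  | and {Γ : Ctx} : Tm Γ Ty.om → Tm Γ Ty.om → Tm Γ Ty.om
  | or {Γ : Ctx} : Tm Γ Ty.om → Tm Γ Ty.om → Tm Γ Ty.om
  | imp {Γ : Ctx} : Tm Γ Ty.om → Tm Γ Ty.om → Tm Γ Ty.om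
  | all {Γ : Ctx} (A : Ty) : Tm (A :: Γ) Ty.om → Tm Γ Ty.om
  | ex {Γ : Ctx} (A : Ty) : Tm (A :: Γ) Ty.om → Tm Γ Ty.om

/-- Formulas are terms of the type of truth values. -/
abbrev Fm (Γ : Ctx) : Type := Tm Γ Ty.om

/-- Sentences are closed formulas. -/
abbrev Sentence : Type := Fm []

infix:70 " ∈ₒ " => Tm.mem
infix:70 " =ₒ " => Tm.eq
infixr:65 " ∧ₒ " => Tm.and
infixr:62 " ∨ₒ " => Tm.or
infixr:60 " →ₒ " => Tm.imp

/-! ### Renaming and substitution -/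

/-- Renamings of variables. -/
abbrev Ren (Γ Δ : Ctx) : Type := ∀ A : Ty, Var Γ A → Var Δ A

/-- Extend a renaming under a binder. -/
def Ren.lift {Γ Δ : Ctx} (ρ : Ren Γ Δ) (B : Ty) : Ren (B :: Γ) (B :: Δ)
  | _, Var.z => Var.z
  | _, Var.s x => Var.s (ρ _ x)

/-- Rename the free variables of a term. -/
def Tm.ren : {Γ : Ctx} → {A : Ty} → Tm Γ A → {Δ : Ctx} → Ren Γ Δ → Tm Δ A
  | _, _, .var x, _, ρ => .var (ρ _ x)
  | _, _, .star, _, _ => .star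
  | _, _, .zero, _, _ => .zero
  | _, _, .succ a, _, ρ => .succ (a.ren ρ)
  | _, _, .pair a b, _, ρ => .pair (a.ren ρ) (b.ren ρ)
  | _, _, .compr A φ, _, ρ => .compr A (φ.ren (ρ.lift A))
  | _, _, .mem a b, _, ρ => .mem (a.ren ρ) (b.ren ρ)
  | _, _, .eq a b, _, ρ => .eq (a.ren ρ) (b.ren ρ)
  | _, _, .top, _, _ => .top
  | _, _, .bot, _, _ => .bot
  | _, _, .and φ ψ, _, ρ => .and (φ.ren ρ) (ψ.ren ρ)
  | _, _, .or φ ψ, _, ρ => .or (φ.ren ρ) (ψ.ren ρ)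
  | _, _, .imp φ ψ, _, ρ => .imp (φ.ren ρ) (ψ.ren ρ)
  | _, _, .all A φ, _, ρ => .all A (φ.ren (ρ.lift A))
  | _, _, .ex A φ, _, ρ => .ex A (φ.ren (ρ.lift A))

/-- Weakening by one variable. -/
def wk {Γ : Ctx} {A B : Ty} (a : Tm Γ A) : Tm (B :: Γ) A := a.ren (fun _ x => Var.s x)

/-- A closed term in an arbitrary context. -/
def Tm.close {A : Ty} (a : Tm [] A) (Γ : Ctx) : Tm Γ A := a.ren (fun _ x => nomatch x)

/-- Substitutions of terms for variables. -/
abbrev Sub (Γ Δ : Ctx) : Type := ∀ A : Ty, Var Γ A → Tm Δ A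

/-- Extend a substitution under a binder. -/
def Sub.lift {Γ Δ : Ctx} (σ : Sub Γ Δ) (B : Ty) : Sub (B :: Γ) (B :: Δ)
  | _, Var.z => .var Var.z
  | _, Var.s x => wk (σ _ x)

/-- Simultaneous capture-avoiding substitution. -/
def Tm.sub : {Γ : Ctx} → {A : Ty} → Tm Γ A → {Δ : Ctx} → Sub Γ Δ → Tm Δ A
  | _, _, .var x, _, σ => σ _ x
  | _, _, .star, _, _ => .star
  | _, _, .zero, _, _ => .zero
  | _, _, .succ a, _, σ => .succ (a.sub σ)
  | _, _, .pair a b, _, σ => .pair (a.sub σ) (b.sub σ)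
  | _, _, .compr A φ, _, σ => .compr A (φ.sub (σ.lift A))
  | _, _, .mem a b, _, σ => .mem (a.sub σ) (b.sub σ)
  | _, _, .eq a b, _, σ => .eq (a.sub σ) (b.sub σ)
  | _, _, .top, _, _ => .top
  | _, _, .bot, _, _ => .bot
  | _, _, .and φ ψ, _, σ => .and (φ.sub σ) (ψ.sub σ)
  | _, _, .or φ ψ, _, σ => .or (φ.sub σ) (ψ.sub σ)
  | _, _, .imp φ ψ, _, σ => .imp (φ.sub σ) (ψ.sub σ)
  | _, _, .all A φ, _, σ => .all A (φ.sub (σ.lift A))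
  | _, _, .ex A φ, _, σ => .ex A (φ.sub (σ.lift A))

/-- The substitution of `a` for the most recently bound variable. -/
def Sub.single {Γ : Ctx} {B : Ty} (a : Tm Γ B) : Sub (B :: Γ) Γ
  | _, Var.z => a
  | _, Var.s x => .var x

/-- `φ.inst a` is `φ` with `a` substituted for the most recently bound variable. -/
def Tm.inst {Γ : Ctx} {A B : Ty} (φ : Tm (B :: Γ) A) (a : Tm Γ B) : Tm Γ A :=
  φ.sub (Sub.single a)

/-! ### Variables and derived formulas -/

abbrev v0 {Γ : Ctx} {A : Ty} : Tm (A :: Γ) A := .var .z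
abbrev v1 {Γ : Ctx} {A B : Ty} : Tm (B :: A :: Γ) A := .var (.s .z)
abbrev v2 {Γ : Ctx} {A B C : Ty} : Tm (C :: B :: A :: Γ) A := .var (.s (.s .z))
abbrev v3 {Γ : Ctx} {A B C D : Ty} : Tm (D :: C :: B :: A :: Γ) A := .var (.s (.s (.s .z)))

/-- Logical equivalence. -/
def Tm.iff {Γ : Ctx} (φ ψ : Fm Γ) : Fm Γ := (φ →ₒ ψ) ∧ₒ (ψ →ₒ φ)

/-- Negation. -/
def Tm.neg {Γ : Ctx} (φ : Fm Γ) : Fm Γ := φ →ₒ .bot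

infix:61 " ↔ₒ " => Tm.iff

/-! ### Derivability -/

/-- `Prf T Δ φ`: the formula `φ` is derivable from the hypotheses `Δ` and the sentences of `T` in
higher-order intuitionistic logic: natural deduction for intuitionistic predicate logic with
equality, extensionality of truth values, comprehension and extensionality for sets, the laws of
the one-element type and of pairs, and Peano's axioms. -/
inductive Prf (T : Set Sentence) : {Γ : Ctx} → List (Fm Γ) → Fm Γ → Prop
  -- axioms of the theory and hypotheses
  | ax {Γ : Ctx} {Δ : List (Fm Γ)} {φ : Sentence} : φ ∈ T → Prf T Δ (φ.close Γ)
  | hyp {Γ : Ctx} {Δ : List (Fm Γ)} {φ : Fm Γ} : φ ∈ Δ → Prf T Δ φ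
  -- intuitionistic predicate logic
  | topI {Γ : Ctx} {Δ : List (Fm Γ)} : Prf T Δ .top
  | botE {Γ : Ctx} {Δ : List (Fm Γ)} {φ : Fm Γ} : Prf T Δ .bot → Prf T Δ φ
  | andI {Γ : Ctx} {Δ : List (Fm Γ)} {φ ψ : Fm Γ} :
      Prf T Δ φ → Prf T Δ ψ → Prf T Δ (φ ∧ₒ ψ)
  | andE1 {Γ : Ctx} {Δ : List (Fm Γ)} {φ ψ : Fm Γ} : Prf T Δ (φ ∧ₒ ψ) → Prf T Δ φ
  | andE2 {Γ : Ctx} {Δ : List (Fm Γ)} {φ ψ : Fm Γ} : Prf T Δ (φ ∧ₒ ψ) → Prf T Δ ψ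
  | orI1 {Γ : Ctx} {Δ : List (Fm Γ)} {φ ψ : Fm Γ} : Prf T Δ φ → Prf T Δ (φ ∨ₒ ψ)
  | orI2 {Γ : Ctx} {Δ : List (Fm Γ)} {φ ψ : Fm Γ} : Prf T Δ ψ → Prf T Δ (φ ∨ₒ ψ)
  | orE {Γ : Ctx} {Δ : List (Fm Γ)} {φ ψ χ : Fm Γ} :
      Prf T Δ (φ ∨ₒ ψ) → Prf T (φ :: Δ) χ → Prf T (ψ :: Δ) χ → Prf T Δ χ
  | impI {Γ : Ctx} {Δ : List (Fm Γ)} {φ ψ : Fm Γ} : Prf T (φ :: Δ) ψ → Prf T Δ (φ →ₒ ψ)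
  | impE {Γ : Ctx} {Δ : List (Fm Γ)} {φ ψ : Fm Γ} :
      Prf T Δ (φ →ₒ ψ) → Prf T Δ φ → Prf T Δ ψ
  | allI {Γ : Ctx} {Δ : List (Fm Γ)} {A : Ty} {φ : Fm (A :: Γ)} :
      Prf T (Δ.map wk) φ → Prf T Δ (.all A φ)
  | allE {Γ : Ctx} {Δ : List (Fm Γ)} {A : Ty} {φ : Fm (A :: Γ)} (a : Tm Γ A) :
      Prf T Δ (.all A φ) → Prf T Δ (φ.inst a)
  | exI {Γ : Ctx} {Δ : List (Fm Γ)} {A : Ty} {φ : Fm (A :: Γ)} (a : Tm Γ A) :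
      Prf T Δ (φ.inst a) → Prf T Δ (.ex A φ)
  | exE {Γ : Ctx} {Δ : List (Fm Γ)} {A : Ty} {φ : Fm (A :: Γ)} {χ : Fm Γ} :
      Prf T Δ (.ex A φ) → Prf T (φ :: Δ.map wk) (wk χ) → Prf T Δ χ
  -- equality
  | eqI {Γ : Ctx} {Δ : List (Fm Γ)} {A : Ty} (a : Tm Γ A) : Prf T Δ (a =ₒ a)
  | eqE {Γ : Ctx} {Δ : List (Fm Γ)} {A : Ty} {a b : Tm Γ A} (φ : Fm (A :: Γ)) :
      Prf T Δ (a =ₒ b) → Prf T Δ (φ.inst a) → Prf T Δ (φ.inst b)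
  -- truth values and sets
  | propExt {Γ : Ctx} {Δ : List (Fm Γ)} {φ ψ : Fm Γ} : Prf T Δ (φ ↔ₒ ψ) → Prf T Δ (φ =ₒ ψ)
  | setExt {Γ : Ctx} {Δ : List (Fm Γ)} {A : Ty} {X Y : Tm Γ (.pow A)} :
      Prf T Δ (.all A (v0 ∈ₒ wk X ↔ₒ v0 ∈ₒ wk Y)) → Prf T Δ (X =ₒ Y)
  | memI {Γ : Ctx} {Δ : List (Fm Γ)} {A : Ty} {φ : Fm (A :: Γ)} {a : Tm Γ A} :
      Prf T Δ (φ.inst a) → Prf T Δ (a ∈ₒ .compr A φ)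
  | memE {Γ : Ctx} {Δ : List (Fm Γ)} {A : Ty} {φ : Fm (A :: Γ)} {a : Tm Γ A} :
      Prf T Δ (a ∈ₒ .compr A φ) → Prf T Δ (φ.inst a)
  -- the one-element type and pairs
  | oneEta {Γ : Ctx} {Δ : List (Fm Γ)} (a : Tm Γ .one) : Prf T Δ (a =ₒ .star)
  | pairInj1 {Γ : Ctx} {Δ : List (Fm Γ)} {A B : Ty} {a c : Tm Γ A} {b d : Tm Γ B} :
      Prf T Δ (.pair a b =ₒ .pair c d) → Prf T Δ (a =ₒ c)
  | pairInj2 {Γ : Ctx} {Δ : List (Fm Γ)} {A B : Ty} {a c : Tm Γ A} {b d : Tm Γ B} :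
      Prf T Δ (.pair a b =ₒ .pair c d) → Prf T Δ (b =ₒ d)
  | pairSurj {Γ : Ctx} {Δ : List (Fm Γ)} {A B : Ty} (c : Tm Γ (.prod A B)) :
      Prf T Δ (.ex A (.ex B (wk (wk c) =ₒ .pair v1 v0)))
  -- natural numbers
  | succNeZero {Γ : Ctx} {Δ : List (Fm Γ)} {n : Tm Γ .nat} :
      Prf T Δ (.succ n =ₒ .zero) → Prf T Δ .bot
  | succInj {Γ : Ctx} {Δ : List (Fm Γ)} {m n : Tm Γ .nat} :
      Prf T Δ (.succ m =ₒ .succ n) → Prf T Δ (m =ₒ n)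
  | induction {Γ : Ctx} {Δ : List (Fm Γ)} {X : Tm Γ (.pow .nat)} (n : Tm Γ .nat) :
      Prf T Δ (.zero ∈ₒ X) → Prf T Δ (.all .nat (v0 ∈ₒ wk X →ₒ .succ v0 ∈ₒ wk X)) →
      Prf T Δ (n ∈ₒ X)

/-- A sentence is a theorem of the theory with axioms `T`. -/
def Theorem (T : Set Sentence) (φ : Sentence) : Prop := Prf T [] φ

/-! ### Sets, maps and multivalued maps -/

/-- The set of all elements of a type. -/
def univ {Γ : Ctx} (A : Ty) : Tm Γ (.pow A) := .compr A .top

/-- The set `X → Y` of maps from `X` to `Y`: the functional relations, contained in the product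
of `X` and `Y`, that are total on `X`. -/
def maps {Γ : Ctx} {A B : Ty} (X : Tm Γ (.pow A)) (Y : Tm Γ (.pow B)) :
    Tm Γ (.pow (.pow (.prod A B))) :=
  .compr (.pow (.prod A B))
    (.all A (.all B (.pair v1 v0 ∈ₒ v2 →ₒ v1 ∈ₒ wk (wk (wk X)) ∧ₒ v0 ∈ₒ wk (wk (wk Y)))) ∧ₒ
      .all A (v0 ∈ₒ wk (wk X) →ₒ .ex B (.pair v1 v0 ∈ₒ v2)) ∧ₒ
      .all A (.all B (.all B (.pair v2 v1 ∈ₒ v3 ∧ₒ .pair v2 v0 ∈ₒ v3 →ₒ v1 =ₒ v0))))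

/-- The set of inhabited subsets of `Y`. -/
def inhab {Γ : Ctx} {B : Ty} (Y : Tm Γ (.pow B)) : Tm Γ (.pow (.pow B)) :=
  .compr (.pow B) (.all B (v0 ∈ₒ v1 →ₒ v0 ∈ₒ wk (wk Y)) ∧ₒ .ex B (v0 ∈ₒ v1))

/-- The set of multivalued maps from `X` to `Y`: the maps from `X` to the inhabited subsets of
`Y`. -/
def multimaps {Γ : Ctx} {A B : Ty} (X : Tm Γ (.pow A)) (Y : Tm Γ (.pow B)) :
    Tm Γ (.pow (.pow (.prod A (.pow B)))) :=
  maps X (inhab Y)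

/-! ### Binary sequences, semidecidable truth values, the one-point compactification of ℕ -/

/-- The number one. -/
def one {Γ : Ctx} : Tm Γ .nat := .succ .zero

/-- The set `2 = {0, 1}`. -/
def two {Γ : Ctx} : Tm Γ (.pow .nat) := .compr .nat (v0 =ₒ .zero ∨ₒ v0 =ₒ one)

/-- The type to which the (graphs of) binary sequences belong. -/
abbrev Seq : Ty := .pow (.prod .nat .nat)

/-- The set `2 ^ ℕ` of binary sequences. -/
def binSeq {Γ : Ctx} : Tm Γ (.pow Seq) := maps (univ .nat) two

/-- The Rosolini dominance `Σ`: the truth values `p` for which there is `f ∈ 2 ^ ℕ` such that `p`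
is equivalent to `∃ n, f n = 1`. -/
def sigma {Γ : Ctx} : Tm Γ (.pow .om) :=
  .compr .om (.ex Seq (v0 ∈ₒ binSeq ∧ₒ (v1 ↔ₒ .ex .nat (.pair v0 one ∈ₒ v1))))

/-- The set `Σ ^ ℕ` of semidecidable subsets of `ℕ`. -/
def sigmaSeq {Γ : Ctx} : Tm Γ (.pow (.pow (.prod .nat .om))) := maps (univ .nat) sigma

/-- The order `b ≤ c` of elements `b`, `c` of `2`. -/
def leTwo {Γ : Ctx} (b c : Tm Γ .nat) : Fm Γ := b =ₒ .zero ∨ₒ c =ₒ one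

/-- The set `ℕ∞` of binary sequences `t` with `t n ≥ t (n + 1)` for all `n`. -/
def natInf {Γ : Ctx} : Tm Γ (.pow Seq) :=
  .compr Seq (v0 ∈ₒ binSeq ∧ₒ
    .all .nat (.all .nat (.all .nat
      (.pair v2 v1 ∈ₒ v3 ∧ₒ .pair (.succ v2) v0 ∈ₒ v3 →ₒ leTwo v0 v1))))

/-- The point `∞` of `ℕ∞`: the sequence of all ones. -/
def infty {Γ : Ctx} : Tm Γ Seq := .compr (.prod .nat .nat) (.ex .nat (v1 =ₒ .pair v0 one))

/-- The strict order `i < n` of natural numbers: `n` belongs to every set that contains `i + 1`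
and is closed under successor. -/
def lt {Γ : Ctx} (i n : Tm Γ .nat) : Fm Γ :=
  .all (.pow .nat)
    (.succ (wk i) ∈ₒ v0 ∧ₒ .all .nat (v0 ∈ₒ v1 →ₒ .succ v0 ∈ₒ v1) →ₒ wk n ∈ₒ v0)

/-- The point of `ℕ∞` that corresponds to a natural number `n`: the binary sequence whose `i`-th
term is `1` if and only if `i < n`. -/
def ofNat {Γ : Ctx} (n : Tm Γ .nat) : Tm Γ Seq :=
  .compr (.prod .nat .nat) (.ex .nat (.ex .nat
    (v2 =ₒ .pair v1 v0 ∧ₒ v0 ∈ₒ two ∧ₒ (v0 =ₒ one ↔ₒ lt v1 (wk (wk (wk n)))))))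

/-! ### The axioms -/

/-- Countable Choice for the type `A`: every total relation between the natural numbers and `A`
contains the graph of a map. -/
def countableChoice (A : Ty) : Sentence :=
  .all (.pow (.prod .nat A))
    (.all .nat (.ex A (.pair v1 v0 ∈ₒ v2)) →ₒ
      .ex (.pow (.prod .nat A)) (v0 ∈ₒ maps (univ .nat) (univ A) ∧ₒ
        .all .nat (.all A (.pair v1 v0 ∈ₒ v2 →ₒ .pair v1 v0 ∈ₒ v3))))

/-- Markov's principle: if not all terms of a binary sequence are zero, then it contains a one. -/
def markovPrinciple : Sentence :=
  .all Seq (v0 ∈ₒ binSeq →ₒ Tm.neg (.all .nat (.pair v0 .zero ∈ₒ v1)) →ₒ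
    .ex .nat (.pair v0 one ∈ₒ v1))

/-- The Enumerability Axiom: there is a surjection from `ℕ` to `Σ ^ ℕ`. -/
def enumerabilityAxiom : Sentence :=
  .ex (.pow (.prod .nat (.pow (.prod .nat .om))))
    (v0 ∈ₒ maps (univ .nat) sigmaSeq ∧ₒ
      .all (.pow (.prod .nat .om)) (v0 ∈ₒ sigmaSeq →ₒ .ex .nat (.pair v0 v1 ∈ₒ v2)))

/-- The theory with Countable Choice (for all types), the Enumerability Axiom and Markov's
principle. -/
def syntheticComputability : Set Sentence :=
  Set.range countableChoice ∪ {enumerabilityAxiom, markovPrinciple}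

/-! ### The principle -/

/-- For every multivalued map `U` from `ℕ∞` to `Σ` with `U ∞ = {⊤}` there is a natural number `n`
such that `⊤ ∈ U n`. -/
def multivaluedWSO : Sentence :=
  .all (.pow (.prod Seq (.pow .om)))
    (v0 ∈ₒ multimaps natInf sigma ∧ₒ .pair infty (.compr .om (v0 =ₒ .top)) ∈ₒ v0 →ₒ
      .ex .nat (.ex (.pow .om) (.pair (ofNat v1) v0 ∈ₒ v2 ∧ₒ .top ∈ₒ v0)))

end IHOL

namespace IHOL

/-! ### Renaming and substitution -/

attribute [simp] Tm.ren Tm.sub Ren.lift Sub.lift Sub.single Tm.inst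

/-! The mathematical argument has two halves. The first is a multivalued Lawvere fixed point
theorem: every multivalued map `M` from Σ to itself has some `p` with `p ∈ M(p)`. Let `e` enumerate
Σ^ℕ. Countable Choice selects from the total relation `n ↦ M(e_n(n))` a map `f`. Its values are
values of `M`, so `f` lies in Σ^ℕ and equals `e_k` for some `k`. Then `f(k) ∈ M(e_k(k)) = M(f(k))`.
This is `Prf.multivalued_fixed_point`.

The second half turns `U` into such an `M`. If `f` is a binary sequence witnessing `p ∈ Σ`, the
sequence that is one until `f` takes the value one, and zero from then on, is a point `t` of ℕ∞. It
is ∞ when `p` is false and a natural number when `p` is true (`Prf.approx_flat`). The point depends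
on the witness `f` and not only on `p`, so `M(p)` collects the values of `U` at all points `t`
related to `p` in this way; multivaluedness makes choosing a witness unnecessary.

Now let `p ∈ M(p)`, say `p ∈ U(t)`. If `p` were false, then `t = ∞`, so `U(t) = {⊤}` and `p = ⊤`, a
contradiction. Hence `¬¬p`, and Markov's principle gives `p` (`Prf.sigma_stable`). So `t` is some
natural number `n`, and `⊤ = p ∈ U(n)` (`Prf.wso_of_fixed_point`).

Since the claim is derivability in a calculus, the argument is carried out with derived rules for
`Prf`, resting on the substitution calculus and on admissibility of weakening (`Prf.ren`). -/

theorem Ren.lift_comp {Γ Δ Θ : Ctx} (ρ : Ren Γ Δ) (τ : Ren Δ Θ) (B : Ty) :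
    (fun A x => (τ.lift B) A ((ρ.lift B) A x)) = Ren.lift (fun A x => τ A (ρ A x)) B := by
  funext A x; cases x <;> rfl

/-- The composition laws come in a forced order: renaming after renaming, substitution after
renaming, renaming after substitution, substitution after substitution. Lifting a substitution under
a binder weakens its values, so the last two laws need commutation of `wk` with lifts, which comes
from the earlier laws. -/
theorem Tm.ren_ren {Γ : Ctx} {A : Ty} (a : Tm Γ A) : ∀ {Δ Θ : Ctx} (ρ : Ren Γ Δ) (τ : Ren Δ Θ),
    (a.ren ρ).ren τ = a.ren (fun A x => τ A (ρ A x)) := by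
  induction a with
  | compr A φ ih | all A φ ih | ex A φ ih => intro _ _ ρ τ; simp only [Tm.ren, ih, Ren.lift_comp]
  | succ a ih => intro _ _ ρ τ; simp only [Tm.ren, ih]
  | var | star | zero | top | bot => intro _ _ ρ τ; rfl
  | pair _ _ ih₁ ih₂ | mem _ _ ih₁ ih₂ | eq _ _ ih₁ ih₂ | and _ _ ih₁ ih₂ | or _ _ ih₁ ih₂
  | imp _ _ ih₁ ih₂ => intro _ _ ρ τ; simp only [Tm.ren, ih₁, ih₂]

theorem Tm.wk_ren_lift {Γ Δ : Ctx} {A B : Ty} (a : Tm Γ A) (ρ : Ren Γ Δ) :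
    (wk a : Tm (B :: Γ) A).ren (ρ.lift B) = wk (a.ren ρ) := by
  simp [wk, Tm.ren_ren]

theorem Sub.lift_ren {Γ Δ Θ : Ctx} (ρ : Ren Γ Δ) (σ : Sub Δ Θ) (B : Ty) :
    (fun A x => (σ.lift B) A ((ρ.lift B) A x)) = Sub.lift (fun A x => σ A (ρ A x)) B := by
  funext A x; cases x <;> rfl

theorem Tm.ren_sub {Γ : Ctx} {A : Ty} (a : Tm Γ A) : ∀ {Δ Θ : Ctx} (ρ : Ren Γ Δ) (σ : Sub Δ Θ),
    (a.ren ρ).sub σ = a.sub (fun A x => σ A (ρ A x)) := by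
  induction a with
  | compr A φ ih | all A φ ih | ex A φ ih => intro _ _ ρ σ; simp only [Tm.ren, Tm.sub, ih, Sub.lift_ren]
  | succ a ih => intro _ _ ρ σ; simp only [Tm.ren, Tm.sub, ih]
  | var | star | zero | top | bot => intro _ _ ρ σ; rfl
  | pair _ _ ih₁ ih₂ | mem _ _ ih₁ ih₂ | eq _ _ ih₁ ih₂ | and _ _ ih₁ ih₂ | or _ _ ih₁ ih₂
  | imp _ _ ih₁ ih₂ => intro _ _ ρ σ; simp only [Tm.ren, Tm.sub, ih₁, ih₂]

theorem Ren.lift_sub {Γ Δ Θ : Ctx} (σ : Sub Γ Δ) (ρ : Ren Δ Θ) (B : Ty) :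
    (fun A x => ((σ.lift B) A x).ren (ρ.lift B)) = Sub.lift (fun A x => (σ A x).ren ρ) B := by
  funext A x; cases x <;> simp [Tm.wk_ren_lift]

theorem Tm.sub_ren {Γ : Ctx} {A : Ty} (a : Tm Γ A) : ∀ {Δ Θ : Ctx} (σ : Sub Γ Δ) (ρ : Ren Δ Θ),
    (a.sub σ).ren ρ = a.sub (fun A x => (σ A x).ren ρ) := by
  induction a with
  | compr A φ ih | all A φ ih | ex A φ ih => intro _ _ σ ρ; simp only [Tm.ren, Tm.sub, ih, Ren.lift_sub]
  | succ a ih => intro _ _ σ ρ; simp only [Tm.ren, Tm.sub, ih]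
  | var | star | zero | top | bot => intro _ _ σ ρ; rfl
  | pair _ _ ih₁ ih₂ | mem _ _ ih₁ ih₂ | eq _ _ ih₁ ih₂ | and _ _ ih₁ ih₂ | or _ _ ih₁ ih₂
  | imp _ _ ih₁ ih₂ => intro _ _ σ ρ; simp only [Tm.ren, Tm.sub, ih₁, ih₂]

theorem Tm.wk_sub_lift {Γ Δ : Ctx} {A B : Ty} (a : Tm Γ A) (σ : Sub Γ Δ) :
    (wk a : Tm (B :: Γ) A).sub (σ.lift B) = wk (a.sub σ) := by
  simp [wk, Tm.ren_sub, Tm.sub_ren]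

theorem Sub.lift_comp {Γ Δ Θ : Ctx} (σ : Sub Γ Δ) (τ : Sub Δ Θ) (B : Ty) :
    (fun A x => ((σ.lift B) A x).sub (τ.lift B)) = Sub.lift (fun A x => (σ A x).sub τ) B := by
  funext A x; cases x <;> simp [Tm.wk_sub_lift]

theorem Tm.sub_sub {Γ : Ctx} {A : Ty} (a : Tm Γ A) : ∀ {Δ Θ : Ctx} (σ : Sub Γ Δ) (τ : Sub Δ Θ),
    (a.sub σ).sub τ = a.sub (fun A x => (σ A x).sub τ) := by
  induction a with
  | compr A φ ih | all A φ ih | ex A φ ih => intro _ _ σ τ; simp only [Tm.sub, ih, Sub.lift_comp]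
  | succ a ih => intro _ _ σ τ; simp only [Tm.sub, ih]
  | var | star | zero | top | bot => intro _ _ σ τ; rfl
  | pair _ _ ih₁ ih₂ | mem _ _ ih₁ ih₂ | eq _ _ ih₁ ih₂ | and _ _ ih₁ ih₂ | or _ _ ih₁ ih₂
  | imp _ _ ih₁ ih₂ => intro _ _ σ τ; simp only [Tm.sub, ih₁, ih₂]

theorem Sub.lift_var {Γ : Ctx} (B : Ty) :
    Sub.lift (fun A (x : Var Γ A) => Tm.var x) B = fun _ x => Tm.var x := by
  funext A x; cases x <;> rfl

theorem Tm.sub_var {Γ : Ctx} {A : Ty} (a : Tm Γ A) : a.sub (fun _ x => .var x) = a := by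
  induction a with
  | compr A φ ih | all A φ ih | ex A φ ih => simp only [Tm.sub, Sub.lift_var, ih]
  | succ a ih => simp only [Tm.sub, ih]
  | var | star | zero | top | bot => rfl
  | pair _ _ ih₁ ih₂ | mem _ _ ih₁ ih₂ | eq _ _ ih₁ ih₂ | and _ _ ih₁ ih₂ | or _ _ ih₁ ih₂
  | imp _ _ ih₁ ih₂ => simp only [Tm.sub, ih₁, ih₂]

theorem Tm.ren_eq_sub {Γ Δ : Ctx} {A : Ty} (a : Tm Γ A) (ρ : Ren Γ Δ) :
    a.ren ρ = a.sub (fun A x => .var (ρ A x)) := by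
  rw [← Tm.sub_var (a.ren ρ), Tm.ren_sub]

theorem Tm.wk_sub_single {Γ : Ctx} {A B : Ty} (a : Tm Γ A) (b : Tm Γ B) :
    (wk a).sub (Sub.single b) = a := by
  simp [wk, Tm.ren_sub, Tm.sub_var]

theorem Tm.inst_ren {Γ Δ : Ctx} {A B : Ty} (φ : Tm (B :: Γ) A) (a : Tm Γ B) (ρ : Ren Γ Δ) :
    (φ.inst a).ren ρ = (φ.ren (ρ.lift B)).inst (a.ren ρ) := by
  simp only [Tm.inst, Tm.sub_ren, Tm.ren_sub]
  congr 1; funext A x; cases x <;> rfl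

theorem Tm.close_ren {Γ Δ : Ctx} {A : Ty} (a : Tm [] A) (ρ : Ren Γ Δ) :
    (a.close Γ).ren ρ = a.close Δ := by
  simp only [Tm.close, Tm.ren_ren]
  congr 1; funext A x; cases x

/-- Instantiating the variable introduced by a weakening under a binder with the bound variable. -/
theorem Tm.ren_lift_sub_v0 {Γ : Ctx} {A B : Ty} (φ : Tm (B :: Γ) A) :
    (φ.ren (Ren.lift (fun _ x => Var.s x) B)).sub (Sub.single (v0 : Tm (B :: Γ) B)) = φ := by
  rw [Tm.ren_sub]
  conv_rhs => rw [← Tm.sub_var φ]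
  congr 1; funext A x; cases x <;> rfl

/-! ### Weakening commutes with the term formers -/

section wk
variable {Γ : Ctx} {A B C : Ty}

theorem ren_s (a : Tm Γ A) : a.ren (fun _ x => (Var.s x : Var (B :: Γ) _)) = wk a := rfl
@[simp] theorem wk_var (x : Var Γ A) : (wk (.var x) : Tm (B :: Γ) A) = .var x.s := rfl
@[simp] theorem wk_succ (a : Tm Γ .nat) : (wk a.succ : Tm (B :: Γ) _) = .succ (wk a) := rfl
@[simp] theorem wk_pair (a : Tm Γ A) (b : Tm Γ C) :
    (wk (.pair a b) : Tm (B :: Γ) _) = .pair (wk a) (wk b) := rfl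
@[simp] theorem wk_compr (φ : Fm (A :: Γ)) :
    (wk (.compr A φ) : Tm (B :: Γ) _) = .compr A (φ.ren (Ren.lift (fun _ x => .s x) A)) := rfl
@[simp] theorem wk_mem (a : Tm Γ A) (b : Tm Γ (.pow A)) :
    (wk (a ∈ₒ b) : Tm (B :: Γ) _) = (wk a ∈ₒ wk b) := rfl
@[simp] theorem wk_and (φ ψ : Fm Γ) : (wk (φ ∧ₒ ψ) : Tm (B :: Γ) _) = (wk φ ∧ₒ wk ψ) := rfl
@[simp] theorem wk_or (φ ψ : Fm Γ) : (wk (φ ∨ₒ ψ) : Tm (B :: Γ) _) = (wk φ ∨ₒ wk ψ) := rfl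
@[simp] theorem wk_imp (φ ψ : Fm Γ) : (wk (φ →ₒ ψ) : Tm (B :: Γ) _) = (wk φ →ₒ wk ψ) := rfl
@[simp] theorem wk_all (φ : Fm (A :: Γ)) :
    (wk (.all A φ) : Tm (B :: Γ) _) = .all A (φ.ren (Ren.lift (fun _ x => .s x) A)) := rfl
@[simp] theorem wk_ex (φ : Fm (A :: Γ)) :
    (wk (.ex A φ) : Tm (B :: Γ) _) = .ex A (φ.ren (Ren.lift (fun _ x => .s x) A)) := rfl

end wk

attribute [simp] Tm.wk_ren_lift Tm.wk_sub_lift Tm.wk_sub_single Tm.ren_lift_sub_v0 ren_s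

/-! ### Renaming and substitution in the defined sets and relations -/

section defs
variable {Γ Δ : Ctx} {A B C : Ty}

@[simp] theorem iff_ren (φ ψ : Fm Γ) (ρ : Ren Γ Δ) :
    (φ ↔ₒ ψ).ren ρ = (φ.ren ρ ↔ₒ ψ.ren ρ) := rfl
@[simp] theorem iff_sub (φ ψ : Fm Γ) (σ : Sub Γ Δ) :
    (φ ↔ₒ ψ).sub σ = (φ.sub σ ↔ₒ ψ.sub σ) := rfl
@[simp] theorem wk_iff (φ ψ : Fm Γ) : (wk (φ ↔ₒ ψ) : Fm (B :: Γ)) = (wk φ ↔ₒ wk ψ) := rfl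
@[simp] theorem neg_ren (φ : Fm Γ) (ρ : Ren Γ Δ) : φ.neg.ren ρ = (φ.ren ρ).neg := rfl
@[simp] theorem neg_sub (φ : Fm Γ) (σ : Sub Γ Δ) : φ.neg.sub σ = (φ.sub σ).neg := rfl
@[simp] theorem wk_neg (φ : Fm Γ) : (wk φ.neg : Fm (B :: Γ)) = (wk φ).neg := rfl
@[simp] theorem univ_ren (ρ : Ren Γ Δ) : (univ A).ren ρ = univ A := rfl
@[simp] theorem univ_sub (σ : Sub Γ Δ) : (univ A).sub σ = univ A := rfl
@[simp] theorem wk_univ : wk (univ A : Tm Γ _) = (univ A : Tm (B :: Γ) _) := rfl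
@[simp] theorem maps_ren (X : Tm Γ (.pow A)) (Y : Tm Γ (.pow B)) (ρ : Ren Γ Δ) :
    (maps X Y).ren ρ = maps (X.ren ρ) (Y.ren ρ) := by simp [maps]
@[simp] theorem maps_sub (X : Tm Γ (.pow A)) (Y : Tm Γ (.pow B)) (σ : Sub Γ Δ) :
    (maps X Y).sub σ = maps (X.sub σ) (Y.sub σ) := by simp [maps]
@[simp] theorem wk_maps (X : Tm Γ (.pow A)) (Y : Tm Γ (.pow B)) :
    (wk (maps X Y) : Tm (C :: Γ) _) = maps (wk X) (wk Y) := maps_ren _ _ _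
@[simp] theorem inhab_ren (Y : Tm Γ (.pow B)) (ρ : Ren Γ Δ) :
    (inhab Y).ren ρ = inhab (Y.ren ρ) := by simp [inhab]
@[simp] theorem inhab_sub (Y : Tm Γ (.pow B)) (σ : Sub Γ Δ) :
    (inhab Y).sub σ = inhab (Y.sub σ) := by simp [inhab]
@[simp] theorem multimaps_ren (X : Tm Γ (.pow A)) (Y : Tm Γ (.pow B)) (ρ : Ren Γ Δ) :
    (multimaps X Y).ren ρ = multimaps (X.ren ρ) (Y.ren ρ) := by simp [multimaps]
@[simp] theorem wk_multimaps (X : Tm Γ (.pow A)) (Y : Tm Γ (.pow B)) :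
    (wk (multimaps X Y) : Tm (C :: Γ) _) = multimaps (wk X) (wk Y) := multimaps_ren _ _ _
@[simp] theorem one_ren (ρ : Ren Γ Δ) : (one : Tm Γ _).ren ρ = one := rfl
@[simp] theorem one_sub (σ : Sub Γ Δ) : (one : Tm Γ _).sub σ = one := rfl
@[simp] theorem two_ren (ρ : Ren Γ Δ) : (two : Tm Γ _).ren ρ = two := rfl
@[simp] theorem two_sub (σ : Sub Γ Δ) : (two : Tm Γ _).sub σ = two := rfl
@[simp] theorem binSeq_ren (ρ : Ren Γ Δ) : (binSeq : Tm Γ _).ren ρ = binSeq := rfl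
@[simp] theorem binSeq_sub (σ : Sub Γ Δ) : (binSeq : Tm Γ _).sub σ = binSeq := rfl
@[simp] theorem wk_binSeq : wk (binSeq : Tm Γ _) = (binSeq : Tm (B :: Γ) _) := rfl
@[simp] theorem sigma_ren (ρ : Ren Γ Δ) : (sigma : Tm Γ _).ren ρ = sigma := rfl
@[simp] theorem sigma_sub (σ : Sub Γ Δ) : (sigma : Tm Γ _).sub σ = sigma := rfl
@[simp] theorem wk_sigma : wk (sigma : Tm Γ _) = (sigma : Tm (B :: Γ) _) := rfl
@[simp] theorem sigmaSeq_ren (ρ : Ren Γ Δ) : (sigmaSeq : Tm Γ _).ren ρ = sigmaSeq := by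
  simp [sigmaSeq]
@[simp] theorem sigmaSeq_sub (σ : Sub Γ Δ) : (sigmaSeq : Tm Γ _).sub σ = sigmaSeq := by
  simp [sigmaSeq]
@[simp] theorem wk_sigmaSeq : wk (sigmaSeq : Tm Γ _) = (sigmaSeq : Tm (B :: Γ) _) :=
  sigmaSeq_ren _
@[simp] theorem natInf_ren (ρ : Ren Γ Δ) : (natInf : Tm Γ _).ren ρ = natInf := rfl
@[simp] theorem natInf_sub (σ : Sub Γ Δ) : (natInf : Tm Γ _).sub σ = natInf := rfl
@[simp] theorem wk_natInf : wk (natInf : Tm Γ _) = (natInf : Tm (B :: Γ) _) := rfl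
@[simp] theorem infty_ren (ρ : Ren Γ Δ) : (infty : Tm Γ _).ren ρ = infty := rfl
@[simp] theorem infty_sub (σ : Sub Γ Δ) : (infty : Tm Γ _).sub σ = infty := rfl
@[simp] theorem wk_infty : wk (infty : Tm Γ _) = (infty : Tm (B :: Γ) _) := rfl
@[simp] theorem lt_ren (i n : Tm Γ .nat) (ρ : Ren Γ Δ) :
    (lt i n).ren ρ = lt (i.ren ρ) (n.ren ρ) := by simp [lt]
@[simp] theorem lt_sub (i n : Tm Γ .nat) (σ : Sub Γ Δ) :
    (lt i n).sub σ = lt (i.sub σ) (n.sub σ) := by simp [lt]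
@[simp] theorem wk_lt (i n : Tm Γ .nat) : (wk (lt i n) : Fm (B :: Γ)) = lt (wk i) (wk n) :=
  lt_ren _ _ _
@[simp] theorem ofNat_ren (n : Tm Γ .nat) (ρ : Ren Γ Δ) :
    (ofNat n).ren ρ = ofNat (n.ren ρ) := by simp [ofNat]
@[simp] theorem ofNat_sub (n : Tm Γ .nat) (σ : Sub Γ Δ) :
    (ofNat n).sub σ = ofNat (n.sub σ) := by simp [ofNat]
@[simp] theorem wk_ofNat (n : Tm Γ .nat) : (wk (ofNat n) : Tm (B :: Γ) _) = ofNat (wk n) :=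
  ofNat_ren _ _

end defs

/-! ### Weakening and derived rules -/

section rules
variable {T : Set Sentence} {Γ : Ctx} {Δ : List (Fm Γ)} {A B : Ty} {φ ψ χ : Fm Γ}

/-- Induction on derivations. Asking only that the renamed hypotheses occur among `Δ'` lets one
induction cover both weakening by a variable and enlarging the list of hypotheses. -/
theorem Prf.ren (h : Prf T Δ φ) : ∀ {Θ : Ctx} {Δ' : List (Fm Θ)} (ρ : Ren Γ Θ),
    (∀ ψ ∈ Δ, ψ.ren ρ ∈ Δ') → Prf T Δ' (φ.ren ρ) := by
  have lift : ∀ {Γ Θ : Ctx} {A : Ty} {Δ : List (Fm Γ)} {Δ' : List (Fm Θ)} {ρ : Ren Γ Θ},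
      (∀ ψ ∈ Δ, ψ.ren ρ ∈ Δ') →
      ∀ ψ ∈ Δ.map (wk (B := A)), ψ.ren (ρ.lift A) ∈ Δ'.map (wk (B := A)) := by
    intro Γ Θ A Δ Δ' ρ h ψ hψ
    obtain ⟨χ, hχ, rfl⟩ := List.mem_map.1 hψ
    rw [Tm.wk_ren_lift]
    exact List.mem_map_of_mem (h χ hχ)
  have cons : ∀ {Γ Θ : Ctx} {φ : Fm Γ} {Δ : List (Fm Γ)} {Δ' : List (Fm Θ)} {ρ : Ren Γ Θ},
      (∀ ψ ∈ Δ, ψ.ren ρ ∈ Δ') → ∀ ψ ∈ φ :: Δ, ψ.ren ρ ∈ φ.ren ρ :: Δ' := by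
    intro Γ Θ φ Δ Δ' ρ h ψ hψ
    rcases List.mem_cons.1 hψ with rfl | hψ
    · exact List.mem_cons_self
    · exact List.mem_cons_of_mem _ (h ψ hψ)
  induction h with
  | ax h => intro Θ Δ' ρ hρ; rw [Tm.close_ren]; exact .ax h
  | hyp h => intro Θ Δ' ρ hρ; exact .hyp (hρ _ h)
  | topI => intros; exact .topI
  | botE _ ih => intro Θ Δ' ρ hρ; exact .botE (ih ρ hρ)
  | andI _ _ ih₁ ih₂ => intro Θ Δ' ρ hρ; exact .andI (ih₁ ρ hρ) (ih₂ ρ hρ)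
  | andE1 _ ih => intro Θ Δ' ρ hρ; exact .andE1 (ih ρ hρ)
  | andE2 _ ih => intro Θ Δ' ρ hρ; exact .andE2 (ih ρ hρ)
  | orI1 _ ih => intro Θ Δ' ρ hρ; exact .orI1 (ih ρ hρ)
  | orI2 _ ih => intro Θ Δ' ρ hρ; exact .orI2 (ih ρ hρ)
  | orE _ _ _ ih ih₁ ih₂ =>
    intro Θ Δ' ρ hρ; exact .orE (ih ρ hρ) (ih₁ ρ (cons hρ)) (ih₂ ρ (cons hρ))
  | impI _ ih => intro Θ Δ' ρ hρ; exact .impI (ih ρ (cons hρ))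
  | impE _ _ ih₁ ih₂ => intro Θ Δ' ρ hρ; exact .impE (ih₁ ρ hρ) (ih₂ ρ hρ)
  | allI _ ih => intro Θ Δ' ρ hρ; exact .allI (ih _ (lift hρ))
  | allE a _ ih => intro Θ Δ' ρ hρ; rw [Tm.inst_ren]; exact .allE _ (ih ρ hρ)
  | exI a _ ih =>
    intro Θ Δ' ρ hρ; exact .exI (a.ren ρ) (by rw [← Tm.inst_ren]; exact ih ρ hρ)
  | exE _ _ ih₁ ih₂ =>
    intro Θ Δ' ρ hρ
    refine .exE (ih₁ ρ hρ) ?_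
    rw [← Tm.wk_ren_lift]
    exact ih₂ _ (cons (lift hρ))
  | eqI a => intro Θ Δ' ρ hρ; exact .eqI _
  | eqE φ _ _ ih₁ ih₂ =>
    intro Θ Δ' ρ hρ
    rw [Tm.inst_ren]
    exact .eqE _ (ih₁ ρ hρ) (by rw [← Tm.inst_ren]; exact ih₂ ρ hρ)
  | propExt _ ih => intro Θ Δ' ρ hρ; exact .propExt (ih ρ hρ)
  | setExt _ ih =>
    intro Θ Δ' ρ hρ
    exact .setExt (by simpa using ih ρ hρ)
  | memI _ ih => intro Θ Δ' ρ hρ; exact .memI (by rw [← Tm.inst_ren]; exact ih ρ hρ)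
  | memE _ ih => intro Θ Δ' ρ hρ; rw [Tm.inst_ren]; exact .memE (ih ρ hρ)
  | oneEta a => intro Θ Δ' ρ hρ; exact .oneEta _
  | pairInj1 _ ih => intro Θ Δ' ρ hρ; exact .pairInj1 (ih ρ hρ)
  | pairInj2 _ ih => intro Θ Δ' ρ hρ; exact .pairInj2 (ih ρ hρ)
  | pairSurj c =>
    intro Θ Δ' ρ hρ
    simpa using Prf.pairSurj (T := T) (Δ := Δ') (c.ren ρ)
  | succNeZero _ ih => intro Θ Δ' ρ hρ; exact .succNeZero (ih ρ hρ)
  | succInj _ ih => intro Θ Δ' ρ hρ; exact .succInj (ih ρ hρ)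
  | induction n _ _ ih₁ ih₂ =>
    intro Θ Δ' ρ hρ
    exact .induction _ (ih₁ ρ hρ) (by simpa using ih₂ ρ hρ)

theorem Prf.mono {Δ' : List (Fm Γ)} (h : Prf T Δ φ) (hΔ : Δ ⊆ Δ') : Prf T Δ' φ := by
  have key : ∀ ψ : Fm Γ, ψ.ren (fun _ x => x) = ψ := fun ψ => by
    rw [Tm.ren_eq_sub, Tm.sub_var]
  have := h.ren (Δ' := Δ') (fun _ x => x) (fun ψ hψ => by rw [key]; exact hΔ hψ)
  rwa [key] at this

theorem Prf.cons (h : Prf T Δ φ) : Prf T (ψ :: Δ) φ := h.mono (List.subset_cons_self _ _)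

theorem Prf.weaken (h : Prf T Δ φ) : Prf T (Δ.map wk) (wk φ : Fm (A :: Γ)) :=
  h.ren _ fun _ hψ => List.mem_map_of_mem hψ

theorem Prf.hd : Prf T (φ :: Δ) φ := .hyp List.mem_cons_self

theorem Prf.cut (h : Prf T Δ φ) (h' : Prf T (φ :: Δ) ψ) : Prf T Δ ψ := .impE (.impI h') h

end rules

/-! ### Derived rules for equality, membership and induction -/

section rules
variable {T : Set Sentence} {Γ : Ctx} {Δ : List (Fm Γ)} {A B : Ty} {φ ψ χ : Fm Γ}

/-- The results of substitution enter as equations, so that a caller can state the formulas in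
computed form and leave the equations to `simp`. The rules `Prf.mem_compr`, `Prf.all_elim` and
`Prf.ex_intro` have the same form. -/
theorem Prf.eq_subst {a b : Tm Γ A} (φ : Fm (A :: Γ)) {ψ χ : Fm Γ} (h : Prf T Δ (a =ₒ b))
    (hψ : φ.inst a = ψ) (hχ : φ.inst b = χ) (h' : Prf T Δ ψ) : Prf T Δ χ := by
  subst hψ hχ; exact .eqE φ h h'

theorem Prf.symm {a b : Tm Γ A} (h : Prf T Δ (a =ₒ b)) : Prf T Δ (b =ₒ a) :=
  h.eq_subst (v0 =ₒ wk a) (by simp) (by simp) (.eqI a)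

theorem Prf.mp_eq (h : Prf T Δ (φ =ₒ ψ)) (h' : Prf T Δ φ) : Prf T Δ ψ :=
  h.eq_subst v0 (by simp) (by simp) h'

theorem Prf.eq_top (h : Prf T Δ φ) : Prf T Δ (φ =ₒ .top) :=
  .propExt (.andI (.impI .topI) (.impI h.cons))

theorem Prf.of_eq_top (h : Prf T Δ (φ =ₒ .top)) : Prf T Δ φ := h.symm.mp_eq .topI

theorem Prf.mem_left {a b : Tm Γ A} {X : Tm Γ (.pow A)} (h : Prf T Δ (a =ₒ b))
    (h' : Prf T Δ (a ∈ₒ X)) : Prf T Δ (b ∈ₒ X) :=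
  h.eq_subst (v0 ∈ₒ wk X) (by simp) (by simp) h'

theorem Prf.mem_right {a : Tm Γ A} {X Y : Tm Γ (.pow A)} (h : Prf T Δ (X =ₒ Y))
    (h' : Prf T Δ (a ∈ₒ X)) : Prf T Δ (a ∈ₒ Y) :=
  h.eq_subst (wk a ∈ₒ v0) (by simp) (by simp) h'

theorem Prf.pair_left {a b : Tm Γ A} {c : Tm Γ B} {X : Tm Γ (.pow (.prod A B))}
    (h : Prf T Δ (a =ₒ b)) (h' : Prf T Δ (.pair a c ∈ₒ X)) : Prf T Δ (.pair b c ∈ₒ X) :=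
  h.eq_subst (.pair v0 (wk c) ∈ₒ wk X) (by simp) (by simp) h'

theorem Prf.pair_right {a : Tm Γ A} {b c : Tm Γ B} {X : Tm Γ (.pow (.prod A B))}
    (h : Prf T Δ (b =ₒ c)) (h' : Prf T Δ (.pair a b ∈ₒ X)) : Prf T Δ (.pair a c ∈ₒ X) :=
  h.eq_subst (.pair (wk a) v0 ∈ₒ wk X) (by simp) (by simp) h'

theorem Prf.mem_compr {φ : Fm (A :: Γ)} {a : Tm Γ A} (h : φ.inst a = ψ) :
    Prf T Δ (a ∈ₒ .compr A φ) ↔ Prf T Δ ψ := by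
  subst h; exact ⟨.memE, .memI⟩

theorem Prf.all_elim {φ : Fm (A :: Γ)} (h : Prf T Δ (.all A φ)) (a : Tm Γ A)
    (hψ : φ.inst a = ψ) : Prf T Δ ψ := hψ ▸ .allE a h

theorem Prf.ex_intro {φ : Fm (A :: Γ)} (a : Tm Γ A) (h : Prf T Δ ψ)
    (hψ : φ.inst a = ψ) : Prf T Δ (.ex A φ) := .exI a (hψ ▸ h)

/-- Modus ponens under a weakened context. -/
theorem Prf.wkc {ψ : Fm (A :: Γ)} (h : Prf T Δ φ) : Prf T (ψ :: Δ.map wk) (wk φ) :=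
  h.weaken.cons

/-- Induction for formulas. -/
theorem Prf.nat_ind (φ : Fm (.nat :: Γ)) (n : Tm Γ .nat) (h₀ : Prf T Δ (φ.inst .zero))
    (hs : Prf T (φ :: Δ.map wk)
      ((φ.ren (Ren.lift (fun _ x => .s x) .nat)).inst (.succ v0))) : Prf T Δ (φ.inst n) := by
  refine .memE (.induction n (.memI h₀) (.allI (.impI ?_)))
  rw [wk_compr]
  refine .memI (.cut (φ := φ) ?_ (hs.mono ?_))
  · exact (Prf.mem_compr (Tm.ren_lift_sub_v0 φ)).1 .hd
  · simp

/-! ### The order of natural numbers -/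

theorem Prf.lt_elim {i n : Tm Γ .nat} (h : Prf T Δ (lt i n)) (X : Tm Γ (.pow .nat))
    (h₀ : Prf T Δ (.succ i ∈ₒ X)) (hs : Prf T Δ (.all .nat (v0 ∈ₒ wk X →ₒ .succ v0 ∈ₒ wk X))) :
    Prf T Δ (n ∈ₒ X) :=
  (h.all_elim (ψ := .succ i ∈ₒ X ∧ₒ .all .nat (v0 ∈ₒ wk X →ₒ .succ v0 ∈ₒ wk X) →ₒ n ∈ₒ X) X
    (by simp)).impE (.andI h₀ hs)

/-- Induction along the order, starting from the successor of `i`. -/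
theorem Prf.lt_ind {i n : Tm Γ .nat} (h : Prf T Δ (lt i n)) (φ : Fm (.nat :: Γ))
    (h₀ : Prf T Δ (φ.inst (.succ i)))
    (hs : Prf T (φ :: Δ.map wk)
      ((φ.ren (Ren.lift (fun _ x => .s x) .nat)).inst (.succ v0))) : Prf T Δ (φ.inst n) := by
  refine .memE (h.lt_elim (.compr .nat φ) (.memI h₀) (.allI (.impI ?_)))
  rw [wk_compr]
  refine .memI (.cut (φ := φ) ?_ (hs.mono ?_))
  · exact (Prf.mem_compr (Tm.ren_lift_sub_v0 φ)).1 .hd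
  · simp

theorem Prf.lt_succ_self (i : Tm Γ .nat) : Prf T Δ (lt i i.succ) :=
  .allI (.impI (.andE1 .hd))

theorem Prf.lt_succ {i n : Tm Γ .nat} (h : Prf T Δ (lt i n)) : Prf T Δ (lt i n.succ) := by
  refine .allI (.impI ?_)
  refine Prf.impE (φ := wk n ∈ₒ v0) (.all_elim (.andE2 .hd) (wk n) (by simp)) ?_
  exact Prf.lt_elim (i := wk i) (by simpa using h.wkc) v0 (.andE1 .hd) (.andE2 .hd)

theorem Prf.not_lt_zero {i : Tm Γ .nat} (h : Prf T Δ (lt i .zero)) : Prf T Δ φ := by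
  refine .botE (.impE (φ := .zero =ₒ .zero) ?_ (.eqI _))
  -- The formula "x is not zero" holds at every successor, hence at everything above `i`.
  have := h.lt_ind (v0 =ₒ .zero →ₒ .bot) (.impI (.succNeZero .hd)) (.impI (.succNeZero .hd))
  simpa using this

theorem Prf.lt_succ_elim {j n : Tm Γ .nat} (h : Prf T Δ (lt j n.succ)) :
    Prf T Δ (n =ₒ j ∨ₒ lt j n) := by
  -- The order is defined impredicatively, so the statement about the predecessor is built into the
  -- induction formula. The conjunct `j < x` is carried along because at `x + 1` the predecessor is
  -- `x` itself.
  have := h.lt_ind (lt (wk j) v0 ∧ₒ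
    .all .nat (v1 =ₒ .succ v0 →ₒ (v0 =ₒ wk (wk j) ∨ₒ lt (wk (wk j)) v0))) ?_ ?_
  · simp only [Tm.inst, Tm.sub, Sub.single, lt_sub, Tm.wk_sub_single, Tm.wk_sub_lift, Sub.lift,
      wk_succ] at this
    refine .impE (.all_elim (.andE2 this) n ?_) (.eqI n.succ)
    simp
  · simp
    exact .andI (.lt_succ_self j) (.allI (.impI (.orI1 (.symm (.succInj .hd)))))
  · simp
    refine .andI (.lt_succ (.andE1 .hd)) (.allI (.impI (.orI2 ?_)))
    exact Prf.eq_subst (a := v1) (lt (wk (wk (wk j))) v0) (.succInj .hd) (by simp) (by simp)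
      (.andE1 (.cons .hd))

/-- Here `j < i + 1` plays the role of `j ≤ i`; the claim follows by induction on `m` from `i + 1`
upwards. -/
theorem Prf.lt_trans {i j m : Tm Γ .nat} (h : Prf T Δ (lt i m)) (h' : Prf T Δ (lt j i.succ)) :
    Prf T Δ (lt j m) := by
  simpa using h.lt_ind (lt (wk j) v0) (by simpa using h') (by simpa using Prf.lt_succ .hd)

theorem Prf.succ_lt_succ {i m : Tm Γ .nat} (h : Prf T Δ (lt i m)) :
    Prf T Δ (lt i.succ m.succ) := by
  simpa using h.lt_ind (lt (wk i).succ v0.succ) (by simpa using .lt_succ_self _)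
    (by simpa using Prf.lt_succ .hd)

theorem Prf.zero_lt_succ (n : Tm Γ .nat) : Prf T Δ (lt .zero n.succ) := by
  simpa using Prf.nat_ind (lt .zero v0.succ) n (by simpa using .lt_succ_self _)
    (by simpa using Prf.lt_succ .hd)

/-- Decidability of the order, needed because excluded middle is not available. In the induction
step, `m ≤ i` splits into `i = m`, which gives `i < m + 1`, and `m < i`, which gives `m + 1 ≤ i`. -/
theorem Prf.lt_or_lt_succ (i m : Tm Γ .nat) : Prf T Δ (lt i m ∨ₒ lt m i.succ) := by
  have := Prf.nat_ind (T := T) (Δ := Δ) (lt (wk i) v0 ∨ₒ lt v0 (wk i).succ) m ?_ ?_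
  · simpa using this
  · simpa using .orI2 (.zero_lt_succ i)
  · simp
    refine .orE .hd (.orI1 (.lt_succ .hd)) (.orE (.lt_succ_elim .hd) (.orI1 ?_) (.orI2 ?_))
    · exact Prf.eq_subst (lt v0 v1.succ) (.symm .hd) (by simp) (by simp) (.lt_succ_self v0)
    · exact .succ_lt_succ .hd

end rules
/-! ### Relations given by formulas -/

/-- Extend a substitution by a term for one more variable. -/
def Sub.cons {Γ Θ : Ctx} {A : Ty} (σ : Sub Γ Θ) (a : Tm Θ A) : Sub (A :: Γ) Θ
  | _, Var.z => a
  | _, Var.s x => σ _ x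

/-- The substitution of `a` and `b` for the two most recently bound variables. -/
abbrev Sub.two {Γ : Ctx} {A B : Ty} (a : Tm Γ A) (b : Tm Γ B) : Sub (B :: A :: Γ) Γ :=
  Sub.cons (Sub.cons (fun _ x => .var x) a) b

attribute [simp] Sub.cons Tm.sub_var

/-- The relation `{(x, y) | φ}`, with `x` the second and `y` the first variable of `φ`. -/
def rel {Γ : Ctx} {A B : Ty} (φ : Fm (B :: A :: Γ)) : Tm Γ (.pow (.prod A B)) :=
  .compr (.prod A B) (.ex A (.ex B (v2 =ₒ .pair v1 v0 ∧ₒ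
    φ.ren (Ren.lift (Ren.lift (fun _ x => .s x) A) B))))

section rel
variable {T : Set Sentence} {Γ Θ : Ctx} {Δ : List (Fm Γ)} {A B C : Ty} {φ ψ χ : Fm Γ}

@[simp] theorem Tm.wk_sub_cons (a : Tm Γ A) (σ : Sub Γ Θ) (b : Tm Θ B) :
    (wk a).sub (Sub.cons σ b) = a.sub σ := by
  rw [wk, Tm.ren_sub]; rfl

/-- The equality rule replaces one variable at a time, so the two terms are exchanged one after the
other. -/
theorem Prf.sub_cons_cons {a a' : Tm Θ A} {b b' : Tm Θ B} {Δ : List (Fm Θ)} {σ : Sub Γ Θ}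
    (φ : Fm (B :: A :: Γ)) (ha : Prf T Δ (a =ₒ a')) (hb : Prf T Δ (b =ₒ b'))
    (h : Prf T Δ (φ.sub (Sub.cons (Sub.cons σ a) b))) :
    Prf T Δ (φ.sub (Sub.cons (Sub.cons σ a') b')) := by
  have h₁ : Prf T Δ (φ.sub (Sub.cons (Sub.cons σ a') b)) := by
    refine ha.eq_subst (φ.sub (Sub.cons (Sub.cons (fun _ x => wk (σ _ x)) v0) (wk b))) ?_ ?_ h
    all_goals
      rw [Tm.inst, Tm.sub_sub]; congr 1; funext C x
      rcases x with _ | _ | x <;> simp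
  refine hb.eq_subst (φ.sub (Sub.cons (Sub.cons (fun _ x => wk (σ _ x)) (wk a')) v0)) ?_ ?_ h₁
  all_goals
    rw [Tm.inst, Tm.sub_sub]; congr 1; funext C x
    rcases x with _ | _ | x <;> simp

theorem Prf.rel_intro {φ : Fm (B :: A :: Γ)} {a : Tm Γ A} {b : Tm Γ B} (h : Prf T Δ ψ)
    (hψ : φ.sub (Sub.two a b) = ψ) : Prf T Δ (.pair a b ∈ₒ rel φ) := by
  refine .memI (.exI a (.exI b ?_))
  refine .andI (by simpa using .eqI _) ?_
  subst hψ
  convert h using 1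
  simp only [Tm.sub_sub, Tm.ren_sub]
  congr 1; funext C x
  rcases x with _ | _ | x <;> simp

theorem Prf.rel_elim {φ : Fm (B :: A :: Γ)} {a : Tm Γ A} {b : Tm Γ B}
    (h : Prf T Δ (.pair a b ∈ₒ rel φ)) (hψ : φ.sub (Sub.two a b) = ψ) : Prf T Δ ψ := by
  refine .exE (.memE h) (.exE .hd ?_)
  -- Membership provides `x`, `y` with `(a, b) = (x, y)` and `φ(x, y)`. Injectivity of pairing gives
  -- `a = x` and `b = y`, along which `φ` is transported.
  have h₀ : Prf T ((.pair (wk (wk a)) (wk (wk b)) =ₒ .pair v1 v0 ∧ₒ φ) ::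
      List.map wk ((.ex B (.pair (wk (wk a)) (wk (wk b)) =ₒ .pair v1 v0 ∧ₒ φ)) :: Δ.map wk))
      (wk (wk ψ)) := by
    have h₁ := Prf.hd (T := T) (φ := .pair (wk (wk a)) (wk (wk b)) =ₒ .pair v1 v0 ∧ₒ φ)
      (Δ := List.map wk ((.ex B (.pair (wk (wk a)) (wk (wk b)) =ₒ .pair v1 v0 ∧ₒ φ)) :: Δ.map wk))
    have h₂ := Prf.sub_cons_cons (σ := fun _ x => .var (.s (.s x))) φ h₁.andE1.pairInj1.symm
      h₁.andE1.pairInj2.symm ?_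
    · convert h₂ using 1
      subst hψ
      simp only [wk, Tm.sub_ren]
      congr 1; funext C x
      rcases x with _ | _ | x <;> rfl
    · convert h₁.andE2 using 1
      conv_rhs => rw [← Tm.sub_var φ]
      congr 1; funext C x
      rcases x with _ | _ | x <;> rfl
  have key : (φ.ren (Ren.lift (Ren.lift (fun _ x => .s x) A) B)).sub
      (((Sub.single (Tm.pair a b)).lift A).lift B) = φ := by
    rw [Tm.ren_sub]
    conv_rhs => rw [← Tm.sub_var φ]
    congr 1; funext C x
    rcases x with _ | _ | x <;> simp
  convert h₀ using 1
  simp [key]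

/-- Two relations are equal if they relate the same elements. -/
theorem Prf.rel_ext {R S : Tm Γ (.pow (.prod A B))}
    (h : Prf T ((Δ.map wk).map wk) (.pair v1 v0 ∈ₒ wk (wk R) ↔ₒ .pair v1 v0 ∈ₒ wk (wk S))) :
    Prf T Δ (R =ₒ S) := by
  -- Surjectivity of pairing replaces an arbitrary element of the product by a pair.
  refine .setExt (.allI (.exE (.pairSurj v0) (.exE .hd ?_)))
  refine Prf.eq_subst (a := .pair v1 v0) (v0 ∈ₒ wk (wk (wk (wk R))) ↔ₒ v0 ∈ₒ wk (wk (wk (wk S))))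
    (ψ := .pair v1 v0 ∈ₒ wk (wk (wk R)) ↔ₒ .pair v1 v0 ∈ₒ wk (wk (wk S)))
    (.symm .hd) (by simp) (by simp) ?_
  -- The context now also contains the original element of the product; the renaming of `h` skips
  -- that variable.
  have h₁ := h.ren (Δ' := ((Δ.map (wk (B := .prod A B))).map wk).map wk)
    (Ren.lift (Ren.lift (fun _ x => .s x) A) B) (by
      intro χ hχ
      simp only [List.mem_map] at hχ
      obtain ⟨_, ⟨χ, hχ, rfl⟩, rfl⟩ := hχ
      simp
      exact ⟨χ, hχ, rfl⟩)
  simp only [iff_ren, Tm.ren, Ren.lift, Tm.wk_ren_lift, ren_s] at h₁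
  exact h₁.mono (by simp)

end rel

/-! ### Maps -/

section maps
variable {T : Set Sentence} {Γ : Ctx} {Δ : List (Fm Γ)} {A B : Ty}
  {X : Tm Γ (.pow A)} {Y : Tm Γ (.pow B)} {F : Tm Γ (.pow (.prod A B))} {a : Tm Γ A} {b c : Tm Γ B}

theorem Prf.mem_maps : Prf T Δ (F ∈ₒ maps X Y) ↔ Prf T Δ
    (.all A (.all B (.pair v1 v0 ∈ₒ wk (wk F) →ₒ v1 ∈ₒ wk (wk X) ∧ₒ v0 ∈ₒ wk (wk Y))) ∧ₒ
      .all A (v0 ∈ₒ wk X →ₒ .ex B (.pair v1 v0 ∈ₒ wk (wk F))) ∧ₒ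
      .all A (.all B (.all B (.pair v2 v1 ∈ₒ wk (wk (wk F)) ∧ₒ .pair v2 v0 ∈ₒ wk (wk (wk F)) →ₒ
        v1 =ₒ v0)))) := by
  rw [maps]; exact Prf.mem_compr (by simp)

theorem Prf.maps_sub (hF : Prf T Δ (F ∈ₒ maps X Y)) (h : Prf T Δ (.pair a b ∈ₒ F)) :
    Prf T Δ (a ∈ₒ X ∧ₒ b ∈ₒ Y) :=
  (((Prf.mem_maps.1 hF).andE1.all_elim (ψ := .all B (.pair (wk a) v0 ∈ₒ wk F →ₒ
    wk a ∈ₒ wk X ∧ₒ v0 ∈ₒ wk Y)) a (by simp)).all_elim b (by simp)).impE h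

theorem Prf.maps_total (hF : Prf T Δ (F ∈ₒ maps X Y)) (h : Prf T Δ (a ∈ₒ X)) :
    Prf T Δ (.ex B (.pair (wk a) v0 ∈ₒ wk F)) :=
  ((Prf.mem_maps.1 hF).andE2.andE1.all_elim (ψ := a ∈ₒ X →ₒ .ex B (.pair (wk a) v0 ∈ₒ wk F)) a
    (by simp)).impE h

theorem Prf.maps_fun (hF : Prf T Δ (F ∈ₒ maps X Y)) (h : Prf T Δ (.pair a b ∈ₒ F))
    (h' : Prf T Δ (.pair a c ∈ₒ F)) : Prf T Δ (b =ₒ c) :=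
  ((((Prf.mem_maps.1 hF).andE2.andE2.all_elim (ψ := .all B (.all B (.pair (wk (wk a)) v1 ∈ₒ wk (wk F) ∧ₒ
    .pair (wk (wk a)) v0 ∈ₒ wk (wk F) →ₒ v1 =ₒ v0))) a (by simp)).all_elim
    (ψ := .all B (.pair (wk a) (wk b) ∈ₒ wk F ∧ₒ .pair (wk a) v0 ∈ₒ wk F →ₒ wk b =ₒ v0)) b
    (by simp)).all_elim (ψ := .pair a b ∈ₒ F ∧ₒ .pair a c ∈ₒ F →ₒ b =ₒ c) c (by simp)).impE
    (.andI h h')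

theorem Prf.maps_intro
    (h₁ : Prf T ((.pair v1 v0 ∈ₒ wk (wk F)) :: (Δ.map wk).map wk)
      (v1 ∈ₒ wk (wk X) ∧ₒ v0 ∈ₒ wk (wk Y)))
    (h₂ : Prf T ((v0 ∈ₒ wk X) :: Δ.map wk) (.ex B (.pair v1 v0 ∈ₒ wk (wk F))))
    (h₃ : Prf T ((.pair v2 v1 ∈ₒ wk (wk (wk F)) ∧ₒ .pair v2 v0 ∈ₒ wk (wk (wk F))) ::
      ((Δ.map wk).map wk).map wk) (v1 =ₒ v0)) : Prf T Δ (F ∈ₒ maps X Y) :=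
  Prf.mem_maps.2 (.andI (.allI (.allI (.impI h₁))) (.andI (.allI (.impI h₂))
    (.allI (.allI (.allI (.impI h₃))))))

theorem Prf.mem_univ : Prf T Δ (a ∈ₒ univ A) := .memI .topI

end maps
/-! ### Binary sequences -/

section seq
variable {T : Set Sentence} {Γ Θ : Ctx} {Δ : List (Fm Γ)} {B : Ty} {f : Tm Γ Seq}
  {a b i n m : Tm Γ .nat} {φ : Fm Γ}

theorem Prf.mem_two : Prf T Δ (b ∈ₒ two) ↔ Prf T Δ (b =ₒ .zero ∨ₒ b =ₒ one) := by
  rw [two]; exact Prf.mem_compr (by simp)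

theorem Prf.zero_mem_two : Prf T Δ (.zero ∈ₒ two) := Prf.mem_two.2 (.orI1 (.eqI _))

theorem Prf.one_mem_two : Prf T Δ (one ∈ₒ two) := Prf.mem_two.2 (.orI2 (.eqI _))

theorem Prf.binSeq_total (hf : Prf T Δ (f ∈ₒ binSeq)) (n : Tm Γ .nat) :
    Prf T Δ (.pair n .zero ∈ₒ f ∨ₒ .pair n one ∈ₒ f) := by
  refine .exE (hf.maps_total (a := n) .mem_univ) ?_
  refine .orE (Prf.mem_two.1 (Prf.maps_sub (X := univ .nat) hf.wkc .hd).andE2) (.orI1 ?_) (.orI2 ?_)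
  all_goals exact .pair_right .hd (.cons .hd)

theorem Prf.binSeq_absurd (hf : Prf T Δ (f ∈ₒ binSeq)) (h₀ : Prf T Δ (.pair n .zero ∈ₒ f))
    (h₁ : Prf T Δ (.pair n one ∈ₒ f)) : Prf T Δ φ :=
  .botE (.succNeZero (hf.maps_fun h₁ h₀))

/-- The terms of the sequence `f` with index less than `n` are zero. -/
def zeroBelow (f : Tm Γ Seq) (n : Tm Γ .nat) : Fm Γ :=
  .all .nat (lt v0 (wk n) →ₒ .pair v0 .zero ∈ₒ wk f)

@[simp] theorem zeroBelow_ren (f : Tm Γ Seq) (n : Tm Γ .nat) (ρ : Ren Γ Θ) :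
    (zeroBelow f n).ren ρ = zeroBelow (f.ren ρ) (n.ren ρ) := by simp [zeroBelow]
@[simp] theorem zeroBelow_sub (f : Tm Γ Seq) (n : Tm Γ .nat) (σ : Sub Γ Θ) :
    (zeroBelow f n).sub σ = zeroBelow (f.sub σ) (n.sub σ) := by simp [zeroBelow]
@[simp] theorem wk_zeroBelow (f : Tm Γ Seq) (n : Tm Γ .nat) :
    (wk (zeroBelow f n) : Fm (B :: Γ)) = zeroBelow (wk f) (wk n) := zeroBelow_ren _ _ _

theorem Prf.zeroBelow_elim (h : Prf T Δ (zeroBelow f n)) (hi : Prf T Δ (lt i n)) :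
    Prf T Δ (.pair i .zero ∈ₒ f) :=
  (h.all_elim (ψ := lt i n →ₒ .pair i .zero ∈ₒ f) i (by simp)).impE hi

theorem Prf.zeroBelow_zero : Prf T Δ (zeroBelow f .zero) :=
  .allI (.impI (.not_lt_zero (i := v0) .hd))

theorem Prf.zeroBelow_succ (h : Prf T Δ (zeroBelow f n)) (hn : Prf T Δ (.pair n .zero ∈ₒ f)) :
    Prf T Δ (zeroBelow f n.succ) := by
  refine .allI (.impI (.orE (Prf.lt_succ_elim (j := v0) (n := wk n) .hd) ?_ ?_))
  · exact .pair_left .hd (.cons hn.wkc)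
  · have h' : Prf T (Δ.map wk) (zeroBelow (wk f) (wk n) : Fm (.nat :: Γ)) := by
      simpa using h.weaken (A := .nat)
    exact h'.cons.cons.zeroBelow_elim .hd

/-- The sequence `f` has a first term with value one. -/
def firstOne (f : Tm Γ Seq) : Fm Γ := .ex .nat (.pair v0 one ∈ₒ wk f ∧ₒ zeroBelow (wk f) v0)

@[simp] theorem firstOne_ren (f : Tm Γ Seq) (ρ : Ren Γ Θ) :
    (firstOne f).ren ρ = firstOne (f.ren ρ) := by simp [firstOne]
@[simp] theorem firstOne_sub (f : Tm Γ Seq) (σ : Sub Γ Θ) :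
    (firstOne f).sub σ = firstOne (f.sub σ) := by simp [firstOne]
@[simp] theorem wk_firstOne (f : Tm Γ Seq) :
    (wk (firstOne f) : Fm (B :: Γ)) = firstOne (wk f) := firstOne_ren _ _

/-- Bounded search: the terms of a binary sequence are decidable, so induction on the bound either
passes only zeros or meets a first one. This supplies the instance of the least number principle
that is needed. -/
theorem Prf.zeroBelow_or_firstOne (hf : Prf T Δ (f ∈ₒ binSeq)) (n : Tm Γ .nat) :
    Prf T Δ (zeroBelow f n ∨ₒ firstOne f) := by
  have := Prf.nat_ind (T := T) (Δ := Δ) (zeroBelow (wk f) v0 ∨ₒ firstOne (wk f)) n ?_ ?_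
  · simpa using this
  · simpa using .orI1 .zeroBelow_zero
  · simp
    refine .orE .hd (.orE (hf.wkc.cons.binSeq_total v0) (.orI1 ?_) (.orI2 ?_)) (.orI2 .hd)
    · exact .zeroBelow_succ (.cons .hd) .hd
    · exact .ex_intro v0 (.andI .hd (.cons .hd)) (by simp)

theorem Prf.firstOne_of_ex (hf : Prf T Δ (f ∈ₒ binSeq))
    (h : Prf T Δ (.ex .nat (.pair v0 one ∈ₒ wk f))) : Prf T Δ (firstOne f) := by
  refine .exE h ?_
  rw [wk_firstOne]
  -- With a one at index `n`, the search runs up to `n + 1`, so the outcome that only zeros occur is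
  -- contradictory.
  refine .orE (hf.wkc.zeroBelow_or_firstOne v0.succ) ?_ .hd
  exact hf.wkc.cons.binSeq_absurd (Prf.hd.zeroBelow_elim (.lt_succ_self _)) (.cons .hd)

/-- If `m` is the index of the first one, then `f` vanishes at all indices up to and including `i`
exactly when `i < m`. This is why `flat` tests zeros below the successor of the index: it makes
`flat f` equal to the point `m` without a shift. -/
theorem Prf.zeroBelow_succ_iff (hf : Prf T Δ (f ∈ₒ binSeq)) (hm : Prf T Δ (.pair m one ∈ₒ f))
    (hz : Prf T Δ (zeroBelow f m)) (i : Tm Γ .nat) :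
    Prf T Δ (zeroBelow f i.succ ↔ₒ lt i m) := by
  refine .andI (.impI ?_) (.impI ?_)
  · refine .orE (.lt_or_lt_succ i m) .hd ?_
    exact hf.cons.cons.binSeq_absurd (Prf.zeroBelow_elim (.cons .hd) .hd) hm.cons.cons
  · have hz' : Prf T (Δ.map wk) (zeroBelow (wk f) (wk m) : Fm (.nat :: Γ)) := by
      simpa using hz.weaken (A := .nat)
    refine .allI (.impI ?_)
    refine (hz'.mono ?_).zeroBelow_elim (.lt_trans (i := wk i) ?_ .hd)
    · simp
    · simpa using Prf.cons (Prf.weaken (Prf.hd (T := T) (Δ := Δ) (φ := lt i m)))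

/-- The sequence with terms one as long as the terms of `f` are zero, and zero afterwards. -/
def flat (f : Tm Γ Seq) : Tm Γ Seq :=
  rel (v0 ∈ₒ two ∧ₒ (v0 =ₒ one ↔ₒ zeroBelow (wk (wk f)) v1.succ))

@[simp] theorem flat_ren (f : Tm Γ Seq) (ρ : Ren Γ Θ) : (flat f).ren ρ = flat (f.ren ρ) := by
  simp [flat, rel]
@[simp] theorem flat_sub (f : Tm Γ Seq) (σ : Sub Γ Θ) : (flat f).sub σ = flat (f.sub σ) := by
  simp [flat, rel]
@[simp] theorem wk_flat (f : Tm Γ Seq) : (wk (flat f) : Tm (B :: Γ) _) = flat (wk f) :=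
  flat_ren _ _

/-- Makes the rules for `rel` applicable to `ofNat`. -/
theorem ofNat_eq_rel (n : Tm Γ .nat) :
    ofNat n = rel (v0 ∈ₒ two ∧ₒ (v0 =ₒ one ↔ₒ lt v1 (wk (wk n)))) := by
  simp [ofNat, rel]

theorem Prf.mem_flat : Prf T Δ (.pair a b ∈ₒ flat f) ↔
    Prf T Δ (b ∈ₒ two ∧ₒ (b =ₒ one ↔ₒ zeroBelow f a.succ)) := by
  constructor
  · intro h; rw [flat] at h; exact h.rel_elim (by simp)
  · intro h; rw [flat]; exact h.rel_intro (by simp)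

theorem Prf.mem_ofNat : Prf T Δ (.pair a b ∈ₒ ofNat n) ↔
    Prf T Δ (b ∈ₒ two ∧ₒ (b =ₒ one ↔ₒ lt a n)) := by
  constructor
  · intro h; rw [ofNat_eq_rel] at h; exact h.rel_elim (by simp)
  · intro h; rw [ofNat_eq_rel]; exact h.rel_intro (by simp)

theorem Prf.mem_infty : Prf T Δ (.pair a b ∈ₒ infty) ↔ Prf T Δ (b =ₒ one) := by
  have key : Prf T Δ (.pair a b ∈ₒ infty) ↔
      Prf T Δ (.ex .nat (.pair (wk a) (wk b) =ₒ .pair v0 one)) := by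
    rw [infty]; exact Prf.mem_compr (by simp)
  rw [key]
  constructor
  · intro h; exact .exE h (.pairInj2 .hd)
  · intro h
    refine .ex_intro a (ψ := .pair a b =ₒ .pair a one) ?_ (by simp)
    exact h.symm.eq_subst (.pair (wk a) v0 =ₒ .pair (wk a) one) (ψ := .pair a one =ₒ .pair a one)
      (by simp) (by simp) (.eqI _)

theorem Prf.iff_trans {φ ψ χ : Fm Γ} (h : Prf T Δ (φ ↔ₒ ψ)) (h' : Prf T Δ (ψ ↔ₒ χ)) :
    Prf T Δ (φ ↔ₒ χ) :=
  .andI (.impI (h'.andE1.cons.impE (h.andE1.cons.impE .hd)))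
    (.impI (h.andE2.cons.impE (h'.andE2.cons.impE .hd)))

theorem Prf.iff_symm {φ ψ : Fm Γ} (h : Prf T Δ (φ ↔ₒ ψ)) : Prf T Δ (ψ ↔ₒ φ) :=
  .andI h.andE2 h.andE1

theorem Prf.flat_eq_ofNat (hf : Prf T Δ (f ∈ₒ binSeq)) (hm : Prf T Δ (.pair m one ∈ₒ f))
    (hz : Prf T Δ (zeroBelow f m)) : Prf T Δ (flat f =ₒ ofNat m) := by
  have key : Prf T ((Δ.map wk).map wk)
      (zeroBelow (wk (wk f)) (Tm.succ v1) ↔ₒ lt v1 (wk (wk m)) : Fm (.nat :: .nat :: Γ)) := by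
    refine Prf.zeroBelow_succ_iff (hf.weaken (A := .nat)).weaken
      (hm.weaken (A := .nat)).weaken ?_ v1
    simpa using (hz.weaken (A := .nat)).weaken (A := .nat)
  refine .rel_ext ?_
  rw [wk_flat, wk_flat, wk_ofNat, wk_ofNat]
  refine .andI (.impI ?_) (.impI ?_)
  · have h := Prf.mem_flat.1 (Prf.hd (T := T) (Δ := (Δ.map wk).map wk)
      (φ := .pair v1 v0 ∈ₒ flat (wk (wk f))))
    exact Prf.mem_ofNat.2 (.andI h.andE1 (h.andE2.iff_trans key.cons))
  · have h := Prf.mem_ofNat.1 (Prf.hd (T := T) (Δ := (Δ.map wk).map wk)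
      (φ := .pair v1 v0 ∈ₒ ofNat (wk (wk m))))
    exact Prf.mem_flat.2 (.andI h.andE1 (h.andE2.iff_trans key.cons.iff_symm))

theorem Prf.flat_eq_infty (h : Prf T Δ (.all .nat (zeroBelow (wk f) v0))) :
    Prf T Δ (flat f =ₒ infty) := by
  have key : Prf T ((Δ.map wk).map wk) (zeroBelow (wk (wk f)) (Tm.succ v1) : Fm (.nat :: .nat :: Γ)) :=
    Prf.all_elim (φ := zeroBelow (wk (wk (wk f))) v0)
      (by simpa using (h.weaken (A := .nat)).weaken (A := .nat)) (Tm.succ v1) (by simp)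
  refine .rel_ext ?_
  rw [wk_flat, wk_flat, wk_infty, wk_infty]
  refine .andI (.impI (Prf.mem_infty.2 ?_)) (.impI (Prf.mem_flat.2 (.andI ?_ ?_)))
  · exact (Prf.mem_flat.1 .hd).andE2.andE2.impE key.cons
  · exact .mem_left (.symm (Prf.mem_infty.1 .hd)) .one_mem_two
  · exact .andI (.impI key.cons.cons) (.impI (Prf.mem_infty.1 (.cons .hd)))

/-- Needed for the totality of `flat f`: a term can be declared zero or one only if its defining
condition is decided. -/
theorem Prf.zeroBelow_succ_dec (hf : Prf T Δ (f ∈ₒ binSeq)) (i : Tm Γ .nat) :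
    Prf T Δ (zeroBelow f i.succ ∨ₒ (zeroBelow f i.succ).neg) := by
  refine .orE (hf.zeroBelow_or_firstOne i.succ) (.orI1 .hd) (.exE .hd ?_)
  simp
  have hf' : Prf T ((.pair v0 one ∈ₒ wk f ∧ₒ zeroBelow (wk f) v0) :: (firstOne f :: Δ).map wk)
    (wk f ∈ₒ binSeq) := hf.cons.wkc
  have h := hf'.zeroBelow_succ_iff (m := v0) (.andE1 .hd) (.andE2 .hd) (wk i)
  refine .mono (.orE (.lt_or_lt_succ (wk i) v0) (.orI1 (h.cons.andE2.impE .hd))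
    (.orI2 (.impI ?_))) (by simp)
  exact hf'.cons.cons.binSeq_absurd (Prf.zeroBelow_elim .hd (.cons .hd))
    (.cons (.cons (.andE1 .hd)))

theorem Prf.flat_mem_natInf (hf : Prf T Δ (f ∈ₒ binSeq)) : Prf T Δ (flat f ∈ₒ natInf) := by
  rw [natInf]
  refine (Prf.mem_compr (ψ := flat f ∈ₒ binSeq ∧ₒ .all .nat (.all .nat (.all .nat
      (.pair v2 v1 ∈ₒ flat (wk (wk (wk f))) ∧ₒ .pair (.succ v2) v0 ∈ₒ flat (wk (wk (wk f))) →ₒ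
        leTwo v0 v1)))) (by simp [leTwo])).2 (.andI ?_ ?_)
  · refine .maps_intro ?_ ?_ ?_
    · rw [wk_flat, wk_flat]
      exact .andI .mem_univ (Prf.mem_flat.1 .hd).andE1
    · rw [wk_flat, wk_flat]
      refine .orE (hf.wkc.zeroBelow_succ_dec v0)
        (.ex_intro one (ψ := .pair v0 one ∈ₒ flat (wk f)) (Prf.mem_flat.2 ?_) (by simp))
        (.ex_intro .zero (ψ := .pair v0 .zero ∈ₒ flat (wk f)) (Prf.mem_flat.2 ?_) (by simp))
      · exact .andI .one_mem_two (.andI (.impI (.cons .hd)) (.impI (.eqI _)))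
      · exact .andI .zero_mem_two (.andI (.impI (.botE (.succNeZero (.symm .hd))))
          (.impI (.botE (.impE (.cons .hd) .hd))))
    · rw [wk_flat, wk_flat, wk_flat]
      -- Two elements of `2` that equal one under the same condition are equal; the cases on both
      -- values make this precise.
      have h₁ := fun Δ => Prf.mem_flat.1 (Prf.andE1 (Prf.hd (T := T) (Δ := Δ)
        (φ := Tm.pair v2 v1 ∈ₒ flat (wk (wk (wk f))) ∧ₒ .pair v2 v0 ∈ₒ flat (wk (wk (wk f))))))
      have h₂ := fun Δ => Prf.mem_flat.1 (Prf.andE2 (Prf.hd (T := T) (Δ := Δ)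
        (φ := Tm.pair v2 v1 ∈ₒ flat (wk (wk (wk f))) ∧ₒ .pair v2 v0 ∈ₒ flat (wk (wk (wk f))))))
      refine .orE (Prf.mem_two.1 (h₁ _).andE1) (.orE (Prf.mem_two.1 (h₂ _).andE1.cons) ?_ ?_) ?_
      · exact .eq_subst (v2 =ₒ v0) (.symm .hd) rfl rfl (.cons .hd)
      · refine .eq_subst (v2 =ₒ v0) (.symm .hd) rfl rfl ?_
        exact (h₁ _).cons.cons.andE2.andE2.impE ((h₂ _).cons.cons.andE2.andE1.impE .hd)
      · refine .eq_subst (v0 =ₒ v1) (.symm .hd) rfl rfl (.symm ?_)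
        exact (h₂ _).cons.andE2.andE2.impE ((h₁ _).cons.andE2.andE1.impE .hd)
  · refine .allI (.allI (.allI (.impI ?_)))
    have h₁ := fun Δ => Prf.mem_flat.1 (Prf.andE1 (Prf.hd (T := T) (Δ := Δ)
      (φ := Tm.pair v2 v1 ∈ₒ flat (wk (wk (wk f))) ∧ₒ
        .pair (.succ v2) v0 ∈ₒ flat (wk (wk (wk f))))))
    have h₂ := fun Δ => Prf.mem_flat.1 (Prf.andE2 (Prf.hd (T := T) (Δ := Δ)
      (φ := Tm.pair v2 v1 ∈ₒ flat (wk (wk (wk f))) ∧ₒ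
        .pair (.succ v2) v0 ∈ₒ flat (wk (wk (wk f))))))
    -- Only the case where the later term is one needs an argument: then `f` vanishes on a longer
    -- initial segment, hence on the shorter one, and the earlier term is one too.
    refine .orE (Prf.mem_two.1 (h₂ _).andE1) (.orI1 .hd) (.orI2 ?_)
    refine (h₁ _).cons.andE2.andE2.impE (.allI (.impI ?_))
    have h₃ := ((h₂ (((Δ.map wk).map wk).map wk)).cons.andE2.andE1.impE (Prf.hd (φ := v0 =ₒ one))).weaken (A := .nat)
    rw [wk_zeroBelow] at h₃
    exact h₃.cons.zeroBelow_elim (.lt_succ .hd)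

end seq
/-! ### Semidecidable truth values -/

section sigma
variable {T : Set Sentence} {Γ Θ : Ctx} {Δ : List (Fm Γ)} {A B : Ty} {f : Tm Γ Seq} {p q : Fm Γ}

theorem Prf.mem_sigma : Prf T Δ (p ∈ₒ sigma) ↔
    Prf T Δ (.ex Seq (v0 ∈ₒ binSeq ∧ₒ (wk p ↔ₒ .ex .nat (.pair v0 one ∈ₒ v1)))) := by
  rw [sigma]; exact Prf.mem_compr (by simp)

/-- The point `t` of `ℕ∞` is infinite if `p` is false, and finite if `p` is true. -/
def approx (p : Fm Γ) (t : Tm Γ Seq) : Fm Γ :=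
  (p.neg →ₒ t =ₒ infty) ∧ₒ (p →ₒ .ex .nat (wk t =ₒ ofNat v0))

@[simp] theorem approx_ren (p : Fm Γ) (t : Tm Γ Seq) (ρ : Ren Γ Θ) :
    (approx p t).ren ρ = approx (p.ren ρ) (t.ren ρ) := by simp [approx]
@[simp] theorem approx_sub (p : Fm Γ) (t : Tm Γ Seq) (σ : Sub Γ Θ) :
    (approx p t).sub σ = approx (p.sub σ) (t.sub σ) := by simp [approx]
@[simp] theorem wk_approx (p : Fm Γ) (t : Tm Γ Seq) :
    (wk (approx p t) : Fm (B :: Γ)) = approx (wk p) (wk t) := approx_ren _ _ _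

theorem Prf.approx_flat (hf : Prf T Δ (f ∈ₒ binSeq))
    (hp : Prf T Δ (p ↔ₒ .ex .nat (.pair v0 one ∈ₒ wk f))) : Prf T Δ (approx p (flat f)) := by
  refine .andI (.impI (.flat_eq_infty (.allI ?_))) (.impI ?_)
  -- Under `¬p` the search below any bound cannot find a one, since a one would prove `p`.
  · refine .orE (hf.cons.weaken.zeroBelow_or_firstOne v0) .hd (.botE ?_)
    refine .impE (φ := wk p) ?_ (.impE (φ := .ex .nat (.pair v0 one ∈ₒ wk (wk f))) ?_ ?_)
    · exact Prf.cons (Prf.weaken (φ := p.neg) .hd)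
    · have h := (hp.cons (ψ := p.neg)).weaken (A := .nat)
      rw [wk_iff] at h
      simpa using h.andE2.cons
    · exact .exE .hd (by simpa using .ex_intro v0 (Prf.andE1 .hd) (by simp))
  · refine .exE (hf.cons.firstOne_of_ex (hp.andE1.cons.impE .hd)) ?_
    rw [wk_ex]
    refine .ex_intro v0 (ψ := flat (wk f) =ₒ ofNat v0) ?_ (by simp)
    exact hf.cons.wkc.flat_eq_ofNat (.andE1 .hd) (.andE2 .hd)

/-- When `p` holds, the natural number obtained depends on the position of the first one in the
chosen witness, so existence is all that is claimed. -/
theorem Prf.exists_approx (hp : Prf T Δ (p ∈ₒ sigma)) :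
    Prf T Δ (.ex Seq (v0 ∈ₒ natInf ∧ₒ approx (wk p) v0)) := by
  refine .exE (Prf.mem_sigma.1 hp) ?_
  rw [wk_ex]
  refine .ex_intro (flat v0) (.andI (Prf.flat_mem_natInf (.andE1 .hd))
    (Prf.approx_flat (p := wk p) (.andE1 .hd) (.andE2 .hd))) (by simp)

theorem Prf.markov (hT : markovPrinciple ∈ T) (hf : Prf T Δ (f ∈ₒ binSeq))
    (h : Prf T Δ (Tm.neg (.all .nat (.pair v0 .zero ∈ₒ wk f)))) :
    Prf T Δ (.ex .nat (.pair v0 one ∈ₒ wk f)) := by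
  have := Prf.all_elim (ψ := f ∈ₒ binSeq →ₒ Tm.neg (.all .nat (.pair v0 .zero ∈ₒ wk f)) →ₒ
    .ex .nat (.pair v0 one ∈ₒ wk f)) (.ax (Δ := Δ) hT) f (by simp)
  exact (this.impE hf).impE h

/-- If all terms of a witnessing sequence were zero, then `p` would be false, against `¬¬p`.
Markov's principle therefore finds a one, which proves `p`. -/
theorem Prf.sigma_stable (hT : markovPrinciple ∈ T) (hp : Prf T Δ (p ∈ₒ sigma))
    (h : Prf T Δ p.neg.neg) : Prf T Δ p := by
  refine .exE (Prf.mem_sigma.1 hp) ?_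
  refine (Prf.andE2 (.andE2 .hd)).impE (.markov hT (.andE1 .hd) (.impI ?_))
  refine .impE (φ := (wk p).neg) h.wkc.cons (.impI ?_)
  refine .exE ((Prf.andE1 (.andE2 (.cons (.cons .hd)))).impE .hd) ?_
  refine Prf.binSeq_absurd (f := v1) (n := v0) ?_ (.all_elim (φ := .pair v0 .zero ∈ₒ v2) ?_ v0 ?_)
    .hd
  · refine .cons (.cons (.cons (.andE1 (ψ := wk (wk p) ↔ₒ .ex .nat (.pair v0 one ∈ₒ v2)) ?_)))
    simpa using .hd
  · refine .cons (.cons ?_)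
    simpa using .hd
  · simp

/-! ### The fixed point theorem for multivalued maps -/

theorem Prf.choice (hT : countableChoice A ∈ T) {R : Tm Γ (.pow (.prod .nat A))}
    (h : Prf T Δ (.all .nat (.ex A (.pair v1 v0 ∈ₒ wk (wk R))))) :
    Prf T Δ (.ex (.pow (.prod .nat A)) (v0 ∈ₒ maps (univ .nat) (univ A) ∧ₒ
      .all .nat (.all A (.pair v1 v0 ∈ₒ v2 →ₒ .pair v1 v0 ∈ₒ wk (wk (wk R)))))) := by
  refine Prf.impE (Prf.all_elim (.ax (Δ := Δ) hT) R ?_) h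
  simp

/-- The relation between `n` and the values at `p` of the multivalued map `M`, where `p` is the
`n`-th term of the `n`-th sequence of the enumeration `e`. -/
def diag (e : Tm Γ (.pow (.prod .nat (.pow (.prod .nat .om)))))
    (M : Tm Γ (.pow (.prod .om .om))) : Tm Γ (.pow (.prod .nat .om)) :=
  rel (.ex (.pow (.prod .nat .om)) (.ex .om (.pair v3 v1 ∈ₒ wk (wk (wk (wk e))) ∧ₒ
    .pair v3 v0 ∈ₒ v1 ∧ₒ .pair v0 v2 ∈ₒ wk (wk (wk (wk M))))))

section diag
variable {e : Tm Γ (.pow (.prod .nat (.pow (.prod .nat .om))))} {M : Tm Γ (.pow (.prod .om .om))}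
  {n : Tm Γ .nat} {s : Tm Γ (.pow (.prod .nat .om))}

@[simp] theorem diag_ren (ρ : Ren Γ Θ) : (diag e M).ren ρ = diag (e.ren ρ) (M.ren ρ) := by
  simp [diag, rel]
@[simp] theorem diag_sub (σ : Sub Γ Θ) : (diag e M).sub σ = diag (e.sub σ) (M.sub σ) := by
  simp [diag, rel]
@[simp] theorem wk_diag : (wk (diag e M) : Tm (B :: Γ) _) = diag (wk e) (wk M) :=
  diag_ren _

theorem Prf.mem_diag : Prf T Δ (.pair n q ∈ₒ diag e M) ↔
    Prf T Δ (.ex (.pow (.prod .nat .om)) (.ex .om (.pair (wk (wk n)) v1 ∈ₒ wk (wk e) ∧ₒ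
      .pair (wk (wk n)) v0 ∈ₒ v1 ∧ₒ .pair v0 (wk (wk q)) ∈ₒ wk (wk M)))) := by
  rw [diag]
  exact ⟨fun h => h.rel_elim (by simp), fun h => h.rel_intro (by simp)⟩

theorem Prf.mem_diag_intro (hs : Prf T Δ (.pair n s ∈ₒ e)) (hp : Prf T Δ (.pair n p ∈ₒ s))
    (hq : Prf T Δ (.pair p q ∈ₒ M)) : Prf T Δ (.pair n q ∈ₒ diag e M) := by
  refine Prf.mem_diag.2 (.ex_intro s (ψ := .ex .om (.pair (wk n) (wk s) ∈ₒ wk e ∧ₒ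
    .pair (wk n) v0 ∈ₒ wk s ∧ₒ .pair v0 (wk q) ∈ₒ wk M)) ?_ (by simp))
  exact .ex_intro p (.andI hs (.andI hp hq)) (by simp)

theorem Prf.mem_diag_elim (he : Prf T Δ (e ∈ₒ maps (univ .nat) sigmaSeq))
    (hs : Prf T Δ (.pair n s ∈ₒ e)) (hp : Prf T Δ (.pair n p ∈ₒ s))
    (h : Prf T Δ (.pair n q ∈ₒ diag e M)) : Prf T Δ (.pair p q ∈ₒ M) := by
  -- Both `e` and the sequence `s` are functional, so the witnesses `s'` and `p'` hidden in `diag`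
  -- agree with `s` and `p`. The context is arbitrary because the fact is used under two existential
  -- witnesses.
  have key : ∀ {Γ : Ctx} {Δ : List (Fm Γ)} {e : Tm Γ (.pow (.prod .nat (.pow (.prod .nat .om))))}
      {M : Tm Γ (.pow (.prod .om .om))} {n : Tm Γ .nat} {s s' : Tm Γ (.pow (.prod .nat .om))}
      {p p' q : Fm Γ}, Prf T Δ (e ∈ₒ maps (univ .nat) sigmaSeq) → Prf T Δ (.pair n s ∈ₒ e) →
      Prf T Δ (.pair n p ∈ₒ s) →
      Prf T Δ (.pair n s' ∈ₒ e ∧ₒ .pair n p' ∈ₒ s' ∧ₒ .pair p' q ∈ₒ M) →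
      Prf T Δ (.pair p q ∈ₒ M) := by
    intro Γ Δ e M n s s' p p' q he hs hp h
    have hs' := he.maps_fun h.andE1 hs
    have hp' := Prf.maps_fun (X := univ .nat) (he.maps_sub hs).andE2
      (.mem_right hs' h.andE2.andE1) hp
    exact .pair_left hp' h.andE2.andE2
  have wk_he : ∀ {Δ : List (Fm (.om :: .pow (.prod .nat .om) :: Γ))},
      Prf T Δ (wk (wk (e ∈ₒ maps (univ .nat) sigmaSeq))) →
      Prf T Δ (wk (wk e) ∈ₒ maps (univ .nat) sigmaSeq) := by
    intro Δ h
    simpa only [wk_mem, wk_maps, wk_univ, wk_sigmaSeq] using h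
  refine .exE (Prf.mem_diag.1 h) (.exE .hd ?_)
  exact key (e := wk (wk e)) (n := wk (wk n)) (s := wk (wk s)) (s' := v1) (p := wk (wk p))
    (p' := v0) (q := wk (wk q)) (M := wk (wk M)) (wk_he he.wkc.wkc) hs.wkc.wkc hp.wkc.wkc .hd

end diag
end sigma
section main
variable {T : Set Sentence} {Γ : Ctx} {Δ : List (Fm Γ)} {A B : Ty} {p q : Fm Γ}

/-- Countable Choice delivers a map into the whole type of truth values; this narrows its codomain
to Σ. -/
theorem Prf.maps_restrict {X : Tm Γ (.pow A)} {Y Z : Tm Γ (.pow B)} {F : Tm Γ (.pow (.prod A B))}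
    (hF : Prf T Δ (F ∈ₒ maps X Z))
    (h : Prf T ((.pair v1 v0 ∈ₒ wk (wk F)) :: (Δ.map wk).map wk) (v0 ∈ₒ wk (wk Y))) :
    Prf T Δ (F ∈ₒ maps X Y) := by
  refine Prf.mem_maps.2 (.andI (.allI (.allI (.impI (.andI ?_ h)))) (Prf.mem_maps.1 hF).andE2)
  have hF' : Prf T ((Δ.map wk).map wk) (wk (wk F) ∈ₒ maps (wk (wk X)) (wk (wk Z)) : Fm (B :: A :: Γ)) := by
    simpa only [wk_mem, wk_maps] using (hF.weaken (A := A)).weaken (A := B)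
  exact (hF'.cons.maps_sub .hd).andE1

section fixed
variable {M : Tm Γ (.pow (.prod .om .om))} {e : Tm Γ (.pow (.prod .nat (.pow (.prod .nat .om))))}
  {n : Tm Γ .nat}

theorem Prf.diag_total (he : Prf T Δ (e ∈ₒ maps (univ .nat) sigmaSeq))
    (ht : Prf T Δ (.all .om (v0 ∈ₒ sigma →ₒ .ex .om (.pair v1 v0 ∈ₒ wk (wk M)))))
    (n : Tm Γ .nat) : Prf T Δ (.ex .om (.pair (wk n) v0 ∈ₒ wk (diag e M))) := by
  refine .exE (he.maps_total (a := n) .mem_univ) ?_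
  have he₁ : Prf T ((.pair (wk n) v0 ∈ₒ wk e) :: Δ.map wk) (wk e ∈ₒ maps (univ .nat) sigmaSeq) := by
    simpa only [wk_mem, wk_maps, wk_univ, wk_sigmaSeq] using he.wkc
  have hs := (he₁.maps_sub .hd).andE2
  refine .exE (Prf.maps_total (X := univ .nat) (Y := sigma) (a := wk n) hs .mem_univ) ?_
  have hs₁ : Prf T ((.pair (wk (wk n)) v0 ∈ₒ v1) :: ((.pair (wk n) v0 ∈ₒ wk e) :: Δ.map wk).map wk)
      (v1 ∈ₒ maps (univ .nat) sigma) := by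
    simpa only [wk_mem, wk_maps, wk_univ, wk_sigma, sigmaSeq, wk_var] using hs.wkc
  have hp := (hs₁.maps_sub .hd).andE2
  have ht₁ : Prf T ((.pair (wk (wk n)) v0 ∈ₒ v1) :: ((.pair (wk n) v0 ∈ₒ wk e) :: Δ.map wk).map wk)
      (v0 ∈ₒ sigma →ₒ .ex .om (.pair v1 v0 ∈ₒ wk (wk (wk M)))) :=
    ht.wkc.wkc.all_elim v0 (by simp)
  refine .exE (ht₁.impE hp) ?_
  simp only [wk_ex, Tm.ren, Ren.lift, wk_diag, Tm.wk_ren_lift, ren_s]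
  refine .ex_intro v0 (ψ := .pair (wk (wk (wk n))) v0 ∈ₒ
    diag (wk (wk (wk e))) (wk (wk (wk M)))) ?_ (by simp)
  refine .mem_diag_intro (s := v2) (p := v1) ?_ ?_ .hd
  · exact .cons (.weaken (φ := .pair (wk (wk n)) v1 ∈ₒ wk (wk e)) (.cons (.weaken .hd)))
  · exact .cons (.weaken .hd)

theorem Prf.diag_sigma
    (hs : Prf T Δ (.all .om (.all .om (.pair v1 v0 ∈ₒ wk (wk M) →ₒ v0 ∈ₒ sigma))))
    (h : Prf T Δ (.pair n q ∈ₒ diag e M)) : Prf T Δ (q ∈ₒ sigma) := by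
  refine .exE (Prf.mem_diag.1 h) (.exE .hd ?_)
  refine .impE (φ := .pair v0 (wk (wk q)) ∈ₒ wk (wk M)) ?_ (Prf.andE2 (.andE2 .hd))
  refine .all_elim (φ := .pair v1 v0 ∈ₒ wk (wk (wk M)) →ₒ v0 ∈ₒ sigma) ?_ (wk (wk q)) (by simp)
  exact hs.wkc.wkc.all_elim v0 (by simp)

/-- A multivalued map from `Σ` to itself has a fixed point. -/
theorem Prf.multivalued_fixed_point (hc : countableChoice .om ∈ T) (hen : enumerabilityAxiom ∈ T)
    (ht : Prf T Δ (.all .om (v0 ∈ₒ sigma →ₒ .ex .om (.pair v1 v0 ∈ₒ wk (wk M)))))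
    (hs : Prf T Δ (.all .om (.all .om (.pair v1 v0 ∈ₒ wk (wk M) →ₒ v0 ∈ₒ sigma)))) :
    Prf T Δ (.ex .om (.pair v0 v0 ∈ₒ wk M)) := by
  -- the case of a given enumeration `e`, a choice map `f`, and an index `k` of `f`
  have step₃ : ∀ {Γ : Ctx} {Δ : List (Fm Γ)} {M : Tm Γ (.pow (.prod .om .om))}
      {e : Tm Γ (.pow (.prod .nat (.pow (.prod .nat .om))))} {f : Tm Γ (.pow (.prod .nat .om))}
      {k : Tm Γ .nat}, Prf T Δ (e ∈ₒ maps (univ .nat) sigmaSeq) →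
      Prf T Δ (f ∈ₒ maps (univ .nat) (univ .om)) →
      Prf T Δ (.all .nat (.all .om (.pair v1 v0 ∈ₒ wk (wk f) →ₒ
        .pair v1 v0 ∈ₒ wk (wk (diag e M))))) →
      Prf T Δ (.pair k f ∈ₒ e) → Prf T Δ (.ex .om (.pair v0 v0 ∈ₒ wk M)) := by
    intro Γ Δ M e f k he hf hd hk
    refine .exE (hf.maps_total (a := k) .mem_univ) ?_
    simp only [wk_ex, Tm.ren, Ren.lift, Tm.wk_ren_lift, ren_s]
    have he₁ : Prf T ((.pair (wk k) v0 ∈ₒ wk f) :: Δ.map wk)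
        (wk e ∈ₒ maps (univ .nat) sigmaSeq) := by
      simpa only [wk_mem, wk_maps, wk_univ, wk_sigmaSeq] using he.wkc
    have hd₁ : Prf T ((.pair (wk k) v0 ∈ₒ wk f) :: Δ.map wk)
        (.pair (wk k) v0 ∈ₒ diag (wk e) (wk M)) := by
      refine .impE (φ := .pair (wk k) v0 ∈ₒ wk f) ?_ .hd
      refine .all_elim (φ := .pair (wk (wk k)) v0 ∈ₒ wk (wk f) →ₒ
        .pair (wk (wk k)) v0 ∈ₒ wk (diag (wk e) (wk M))) ?_ v0 (by simp)
      exact hd.wkc.all_elim (wk k) (by simp)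
    -- The value of `f` at `k` is the fixed point: since `f` is the `k`-th sequence, it is both the
    -- argument and a value of `M` on the diagonal.
    exact .ex_intro v0 (he₁.mem_diag_elim hk.wkc .hd hd₁) (by simp)
  have step₂ : ∀ {Γ : Ctx} {Δ : List (Fm Γ)} {M : Tm Γ (.pow (.prod .om .om))}
      {e : Tm Γ (.pow (.prod .nat (.pow (.prod .nat .om))))} {f : Tm Γ (.pow (.prod .nat .om))},
      Prf T Δ (.all .om (.all .om (.pair v1 v0 ∈ₒ wk (wk M) →ₒ v0 ∈ₒ sigma))) →
      Prf T Δ (e ∈ₒ maps (univ .nat) sigmaSeq) →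
      Prf T Δ (.all (.pow (.prod .nat .om)) (v0 ∈ₒ sigmaSeq →ₒ
        .ex .nat (.pair v0 v1 ∈ₒ wk (wk e)))) →
      Prf T Δ (f ∈ₒ maps (univ .nat) (univ .om)) →
      Prf T Δ (.all .nat (.all .om (.pair v1 v0 ∈ₒ wk (wk f) →ₒ
        .pair v1 v0 ∈ₒ wk (wk (diag e M))))) → Prf T Δ (.ex .om (.pair v0 v0 ∈ₒ wk M)) := by
    intro Γ Δ M e f hs he hsurj hf hd
    -- Every value of `f` is a value of `M`, hence semidecidable; this puts `f` in the range of the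
    -- enumeration.
    have hfs : Prf T Δ (f ∈ₒ sigmaSeq) := by
      rw [sigmaSeq]
      refine hf.maps_restrict ?_
      refine .diag_sigma (M := wk (wk M)) (e := wk (wk e)) (n := v1) (q := v0) ?_
        (.impE (φ := .pair v1 v0 ∈ₒ wk (wk f)) ?_ .hd)
      · simpa using ((hs.weaken (A := .nat)).weaken (A := .om)).cons
          (ψ := .pair v1 v0 ∈ₒ wk (wk f))
      · refine .all_elim (φ := .pair v2 v0 ∈ₒ wk (wk (wk f)) →ₒ
          .pair v2 v0 ∈ₒ wk (diag (wk (wk e)) (wk (wk M)))) ?_ v0 (by simp)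
        refine .all_elim (φ := .all .om (.pair v1 v0 ∈ₒ wk (wk (wk (wk f))) →ₒ
          .pair v1 v0 ∈ₒ wk (wk (diag (wk (wk e)) (wk (wk M)))))) ?_ v1 (by simp)
        simpa using ((hd.weaken (A := .nat)).weaken (A := .om)).cons
          (ψ := .pair v1 v0 ∈ₒ wk (wk f))
    have hk : Prf T Δ (.ex .nat (.pair v0 (wk f) ∈ₒ wk e)) :=
      Prf.impE (hsurj.all_elim f (by simp)) hfs
    refine .exE hk ?_
    simp only [wk_ex, Tm.ren, Ren.lift, Tm.wk_ren_lift, ren_s]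
    refine step₃ (M := wk M) (e := wk e) (f := wk f) (k := v0) ?_ ?_ ?_ .hd
    · simpa only [wk_mem, wk_maps, wk_univ, wk_sigmaSeq] using he.wkc
    · simpa only [wk_mem, wk_maps, wk_univ] using hf.wkc
    · simpa using hd.wkc (A := .nat) (ψ := .pair v0 (wk f) ∈ₒ wk e)
  have step₁ : ∀ {Γ : Ctx} {Δ : List (Fm Γ)} {M : Tm Γ (.pow (.prod .om .om))}
      {e : Tm Γ (.pow (.prod .nat (.pow (.prod .nat .om))))},
      Prf T Δ (.all .om (v0 ∈ₒ sigma →ₒ .ex .om (.pair v1 v0 ∈ₒ wk (wk M)))) →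
      Prf T Δ (.all .om (.all .om (.pair v1 v0 ∈ₒ wk (wk M) →ₒ v0 ∈ₒ sigma))) →
      Prf T Δ (e ∈ₒ maps (univ .nat) sigmaSeq) →
      Prf T Δ (.all (.pow (.prod .nat .om)) (v0 ∈ₒ sigmaSeq →ₒ
        .ex .nat (.pair v0 v1 ∈ₒ wk (wk e)))) → Prf T Δ (.ex .om (.pair v0 v0 ∈ₒ wk M)) := by
    intro Γ Δ M e ht hs he hsurj
    refine .exE (.choice hc (R := diag e M) (.allI ?_)) ?_
    · rw [wk_diag]
      refine .diag_total (e := wk e) (M := wk M) (n := v0) ?_ ?_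
      · simpa only [wk_mem, wk_maps, wk_univ, wk_sigmaSeq] using he.weaken (A := .nat)
      · simpa using ht.weaken (A := .nat)
    · simp only [wk_ex, Tm.ren, Ren.lift, Tm.wk_ren_lift, ren_s]
      refine step₂ (M := wk M) (e := wk e) (f := v0) ?_ ?_ ?_ (.andE1 .hd) ?_
      · refine .cons ?_
        simpa using hs.weaken (A := .pow (.prod .nat .om))
      · refine .cons ?_
        simpa only [wk_mem, wk_maps, wk_univ, wk_sigmaSeq] using
          he.weaken (A := .pow (.prod .nat .om))
      · refine .cons ?_
        simpa using hsurj.weaken (A := .pow (.prod .nat .om))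
      · simp only [wk_diag, wk_var]
        exact .andE2 .hd
  have hax : Prf T Δ (.ex (.pow (.prod .nat (.pow (.prod .nat .om))))
    (v0 ∈ₒ maps (univ .nat) sigmaSeq ∧ₒ
      .all (.pow (.prod .nat .om)) (v0 ∈ₒ sigmaSeq →ₒ .ex .nat (.pair v0 v1 ∈ₒ v2)))) := by
    have h := Prf.ax (Δ := Δ) hen
    simpa [enumerabilityAxiom, Tm.close] using h
  refine .exE hax ?_
  simp only [wk_ex, Tm.ren, Ren.lift, Tm.wk_ren_lift, ren_s]
  refine step₁ (M := wk M) (e := v0) (.cons ?_) (.cons ?_) (.andE1 .hd) (.andE2 .hd)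
  · simpa using ht.weaken (A := .pow (.prod .nat (.pow (.prod .nat .om))))
  · simpa using hs.weaken (A := .pow (.prod .nat (.pow (.prod .nat .om))))

end fixed
end main
-- From multivalued maps on ℕ∞ to multivalued maps on Σ, and the conclusion
section wso
variable {T : Set Sentence} {Γ Θ : Ctx} {Δ : List (Fm Γ)} {A B : Ty} {p q : Fm Γ}
  {U : Tm Γ (.pow (.prod Seq (.pow .om)))} {t : Tm Γ Seq} {Y : Tm Γ (.pow .om)}

theorem Prf.mem_inhab {Y : Tm Γ (.pow B)} {Z : Tm Γ (.pow B)} : Prf T Δ (Y ∈ₒ inhab Z) ↔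
    Prf T Δ (.all B (v0 ∈ₒ wk Y →ₒ v0 ∈ₒ wk Z) ∧ₒ .ex B (v0 ∈ₒ wk Y)) := by
  rw [inhab]; exact Prf.mem_compr (by simp)

theorem Prf.wkc_multimaps {φ : Fm (A :: Γ)} (hU : Prf T Δ (U ∈ₒ multimaps natInf sigma)) :
    Prf T (φ :: Δ.map wk) (wk U ∈ₒ multimaps natInf sigma) := by
  simpa only [wk_mem, wk_multimaps, wk_natInf, wk_sigma] using hU.wkc (ψ := φ)

/-- The body of the relation `approxMap`. -/
def approxVal (U : Tm Γ (.pow (.prod Seq (.pow .om)))) (p q : Fm Γ) : Fm Γ :=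
  .ex Seq (.ex (.pow .om) (approx (wk (wk p)) v1 ∧ₒ .pair v1 v0 ∈ₒ wk (wk U) ∧ₒ
    wk (wk q) ∈ₒ v0))

/-- The multivalued map from `Σ` to itself whose values at `p` are the values of `U` at the points
of `ℕ∞` that are finite if `p` is true and infinite if `p` is false. -/
def approxMap (U : Tm Γ (.pow (.prod Seq (.pow .om)))) : Tm Γ (.pow (.prod .om .om)) :=
  rel (approxVal (wk (wk U)) v1 v0)

theorem Prf.mem_approxMap : Prf T Δ (.pair p q ∈ₒ approxMap U) ↔ Prf T Δ (approxVal U p q) := by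
  rw [approxMap]
  exact ⟨fun h => h.rel_elim (by simp [approxVal]), fun h => h.rel_intro (by simp [approxVal])⟩

@[simp] theorem approxMap_ren (ρ : Ren Γ Θ) : (approxMap U).ren ρ = approxMap (U.ren ρ) := by
  simp [approxMap, approxVal, rel]
@[simp] theorem approxMap_sub (σ : Sub Γ Θ) : (approxMap U).sub σ = approxMap (U.sub σ) := by
  simp [approxMap, approxVal, rel]
@[simp] theorem wk_approxMap : (wk (approxMap U) : Tm (B :: Γ) _) = approxMap (wk U) :=
  approxMap_ren _

/-- A semidecidable `p` has a related point `t` in ℕ∞, and `U(t)` is inhabited. -/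
theorem Prf.approxMap_total (hU : Prf T Δ (U ∈ₒ multimaps natInf sigma))
    (hp : Prf T Δ (p ∈ₒ sigma)) : Prf T Δ (.ex .om (.pair (wk p) v0 ∈ₒ wk (approxMap U))) := by
  have step₂ : ∀ {Γ : Ctx} {Δ : List (Fm Γ)} {U : Tm Γ (.pow (.prod Seq (.pow .om)))} {p : Fm Γ}
      {t : Tm Γ Seq} {Y : Tm Γ (.pow .om)}, Prf T Δ (U ∈ₒ multimaps natInf sigma) →
      Prf T Δ (approx p t) → Prf T Δ (.pair t Y ∈ₒ U) →
      Prf T Δ (.ex .om (.pair (wk p) v0 ∈ₒ approxMap (wk U))) := by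
    intro Γ Δ U p t Y hU hp hY
    refine .exE (Prf.mem_inhab.1 (Prf.maps_sub (X := natInf) (Y := inhab sigma) hU hY).andE2).andE2
      ?_
    simp only [wk_ex, Tm.ren, Ren.lift, Tm.wk_ren_lift, ren_s]
    refine .ex_intro v0 (ψ := .pair (wk p) v0 ∈ₒ approxMap (wk U)) (Prf.mem_approxMap.2 ?_) ?_
    · refine .ex_intro (wk t) (ψ := .ex (.pow .om) (approx (wk (wk p)) (wk (wk t)) ∧ₒ
        .pair (wk (wk t)) v0 ∈ₒ wk (wk U) ∧ₒ v1 ∈ₒ v0)) (.ex_intro (wk Y)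
        (ψ := approx (wk p) (wk t) ∧ₒ .pair (wk t) (wk Y) ∈ₒ wk U ∧ₒ v0 ∈ₒ wk Y) ?_ ?_) ?_
      · refine .andI ?_ (.andI hY.wkc .hd)
        simpa only [wk_approx] using hp.wkc
      · simp
      · simp
    · simp
  have step₁ : ∀ {Γ : Ctx} {Δ : List (Fm Γ)} {U : Tm Γ (.pow (.prod Seq (.pow .om)))} {p : Fm Γ}
      {t : Tm Γ Seq}, Prf T Δ (U ∈ₒ multimaps natInf sigma) → Prf T Δ (t ∈ₒ natInf) →
      Prf T Δ (approx p t) → Prf T Δ (.ex .om (.pair (wk p) v0 ∈ₒ approxMap (wk U))) := by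
    intro Γ Δ U p t hU ht hp
    refine .exE (Prf.maps_total (X := natInf) (Y := inhab sigma) hU ht) ?_
    have := step₂ (Δ := (.pair (wk t) v0 ∈ₒ wk U) :: Δ.map wk) (U := wk U) (p := wk p)
      (t := wk t) (Y := v0) ?_ ?_ .hd
    · simpa using this
    · simpa using Prf.wkc (A := .pow .om) (ψ := .pair (wk t) v0 ∈ₒ wk U) hU
    · simpa using hp.wkc (A := .pow .om) (ψ := .pair (wk t) v0 ∈ₒ wk U)
  refine .exE hp.exists_approx ?_
  have := step₁ (Δ := (v0 ∈ₒ natInf ∧ₒ approx (wk p) v0) :: Δ.map wk) (U := wk U)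
    (p := wk p) (t := v0) (.cons ?_) (.andE1 .hd) (.andE2 .hd)
  · simpa using this
  · simpa using hU.weaken (A := Seq)

/-- `approxVal` does not ask that `t` lie in ℕ∞ or that `Y` be a set of semidecidable truth values;
membership of the pair in the graph of `U` ensures that its value lies inside Σ. -/
theorem Prf.approxMap_sigma (hU : Prf T Δ (U ∈ₒ multimaps natInf sigma))
    (h : Prf T Δ (.pair p q ∈ₒ approxMap U)) : Prf T Δ (q ∈ₒ sigma) := by
  have key : ∀ {Γ : Ctx} {Δ : List (Fm Γ)} {U : Tm Γ (.pow (.prod Seq (.pow .om)))} {q φ : Fm Γ}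
      {t : Tm Γ Seq} {Y : Tm Γ (.pow .om)}, Prf T Δ (U ∈ₒ multimaps natInf sigma) →
      Prf T Δ (φ ∧ₒ .pair t Y ∈ₒ U ∧ₒ q ∈ₒ Y) → Prf T Δ (q ∈ₒ sigma) := by
    intro Γ Δ U q φ t Y hU h
    have hY := (Prf.maps_sub (X := natInf) (Y := inhab sigma) hU h.andE2.andE1).andE2
    exact Prf.impE ((Prf.mem_inhab.1 hY).andE1.all_elim q (by simp)) h.andE2.andE2
  refine .exE (Prf.mem_approxMap.1 h) (.exE .hd ?_)
  exact key (U := wk (wk U)) (q := wk (wk q)) (t := v1) (Y := v0)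
    hU.wkc_multimaps.wkc_multimaps .hd

/-- A fixed point of the multivalued map `approxMap U` yields a natural number at which `U` has
the value `⊤`. -/
theorem Prf.wso_of_fixed_point (hT : markovPrinciple ∈ T)
    (hU : Prf T Δ (U ∈ₒ multimaps natInf sigma))
    (hi : Prf T Δ (.pair infty (.compr .om (v0 =ₒ .top)) ∈ₒ U))
    (h : Prf T Δ (.pair p p ∈ₒ approxMap U)) :
    Prf T Δ (.ex .nat (.ex (.pow .om) (.pair (ofNat v1) v0 ∈ₒ wk (wk U) ∧ₒ .top ∈ₒ v0))) := by
  have key : ∀ {Γ : Ctx} {Δ : List (Fm Γ)} {U : Tm Γ (.pow (.prod Seq (.pow .om)))} {p : Fm Γ}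
      {t : Tm Γ Seq} {Y : Tm Γ (.pow .om)}, Prf T Δ (U ∈ₒ multimaps natInf sigma) →
      Prf T Δ (.pair infty (.compr .om (v0 =ₒ .top)) ∈ₒ U) → Prf T Δ (p ∈ₒ sigma) →
      Prf T Δ (approx p t ∧ₒ .pair t Y ∈ₒ U ∧ₒ p ∈ₒ Y) →
      Prf T Δ (.ex .nat (.ex (.pow .om) (.pair (ofNat v1) v0 ∈ₒ wk (wk U) ∧ₒ .top ∈ₒ v0))) := by
    intro Γ Δ U p t Y hU hi hs h
    have hp := h.andE1
    have hY := h.andE2.andE1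
    have hpY := h.andE2.andE2
    -- If `p` is false, then `t` is ∞, so single-valuedness of `U` as a map to sets forces `Y =
    -- {⊤}`; then `p ∈ Y` makes `p` true.
    have hnn : Prf T Δ p.neg.neg := by
      refine .impI ?_
      have ht : Prf T (p.neg :: Δ) (t =ₒ infty) := hp.andE1.cons.impE .hd
      have hY' := Prf.maps_fun (X := natInf) (Y := inhab sigma) hU.cons
        (.pair_left ht hY.cons) hi.cons
      have hp' := (Prf.mem_compr (ψ := p =ₒ .top) (by simp)).1 (hY'.mem_right hpY.cons)
      exact Prf.hd.impE hp'.of_eq_top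
    have hp₁ := hs.sigma_stable hT hnn
    refine .exE (hp.andE2.impE hp₁) ?_
    simp only [wk_ex, Tm.ren, Ren.lift, Tm.wk_ren_lift, ren_s, ofNat_ren]
    refine .ex_intro v0 (ψ := .ex (.pow .om) (.pair (ofNat v1) v0 ∈ₒ wk (wk U) ∧ₒ .top ∈ₒ v0))
      (.ex_intro (wk Y) (ψ := .pair (ofNat v0) (wk Y) ∈ₒ wk U ∧ₒ .top ∈ₒ wk Y) (.andI ?_ ?_) ?_) ?_
    · exact .pair_left .hd hY.wkc
    -- By extensionality a true `p` equals `⊤`, so `p ∈ Y` becomes `⊤ ∈ Y`.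
    · exact (Prf.mem_left hp₁.eq_top hpY).wkc
    · simp
    · simp
  have hs := hU.approxMap_sigma h
  refine .exE (Prf.mem_approxMap.1 h) (.exE .hd ?_)
  simp only [wk_ex, Tm.ren, Ren.lift, Tm.wk_ren_lift, ren_s, ofNat_ren]
  exact key (U := wk (wk U)) (p := wk (wk p)) (t := v1) (Y := v0)
    hU.wkc_multimaps.wkc_multimaps hi.wkc.wkc hs.wkc.wkc .hd

theorem Prf.multivaluedWSO (hc : countableChoice .om ∈ T) (hen : enumerabilityAxiom ∈ T)
    (hm : markovPrinciple ∈ T) (hU : Prf T Δ (U ∈ₒ multimaps natInf sigma))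
    (hi : Prf T Δ (.pair infty (.compr .om (v0 =ₒ .top)) ∈ₒ U)) :
    Prf T Δ (.ex .nat (.ex (.pow .om) (.pair (ofNat v1) v0 ∈ₒ wk (wk U) ∧ₒ .top ∈ₒ v0))) := by
  refine .exE (.multivalued_fixed_point (M := approxMap U) hc hen (.allI (.impI ?_))
    (.allI (.allI (.impI ?_)))) ?_
  · simpa using Prf.approxMap_total (p := v0) (U := wk U) hU.wkc_multimaps .hd
  · rw [wk_approxMap, wk_approxMap]
    refine Prf.approxMap_sigma (U := wk (wk U)) (p := v1) (.cons ?_) .hd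
    simpa only [wk_mem, wk_multimaps, wk_natInf, wk_sigma] using
      (hU.weaken (A := .om)).weaken (A := .om)
  · rw [wk_approxMap]
    simp only [wk_ex, Tm.ren, Ren.lift, Tm.wk_ren_lift, ren_s, ofNat_ren]
    exact Prf.wso_of_fixed_point (U := wk U) (p := v0) hm hU.wkc_multimaps hi.wkc .hd

end wso

end IHOL

/-- Multivalued WSO is a theorem of higher-order intuitionistic logic with Countable Choice, the
Enumerability Axiom and Markov's principle. -/
theorem mainTheorem5 : IHOL.Theorem IHOL.syntheticComputability IHOL.multivaluedWSO := by
  open IHOL in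
  have hc : countableChoice .om ∈ syntheticComputability := .inl ⟨_, rfl⟩
  have hen : enumerabilityAxiom ∈ syntheticComputability := .inr (.inl rfl)
  have hm : markovPrinciple ∈ syntheticComputability := .inr (.inr rfl)
  exact .allI (.impI (.multivaluedWSO hc hen hm (.andE1 .hd) (.andE2 .hd)))
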